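/- For a family $\mathcal U$ of subsets of a metric space $X$ let $L_{\mathcal U}(x)=\sup_{U\in\mathcal U}\operatorname{dist}(x,X\setminus U)\in[0,\infty]$ (with $\operatorname{dist}(x,\emptyset)=\infty$ and $\sup\emptyset=0$), and let the multiplicity of $\mathcal U$ be the supremum over $x\in X$ of the number of elements of $\mathcal U$ containing $x$. The family $\mathcal U$ is called coarse if $L_{\mathcal U}(x)\to\infty$ as $x\to\infty$ (that is, as $x$ leaves every bounded set). The coarse dimension $\dim^{coa}_{rse}(X)$ is the smallest integer $n\ge -1$ such that every finite coarse family $\mathcal U$ in $X$ has a coarse refinement (a coarse family each of whose elements is contained in an element of $\mathcal U$) of multiplicity at most $n+1$; it is $\infty$ if there is no such $n$. A function $f:X\to Y$ of metric spaces is slowly oscillating if $f^{-1}(\mathcal U)$ is coarse for every cover $\mathcal U$ of $Y$ with $\inf_{y\in Y}L_{\mathcal U}(y)>0$. A Higson compactification of $X$ is a compact Hausdorff space $h(X)$ containing $X$ as a dense subspace, such that a bounded continuous function $f:X\to[0,\infty)$ extends to a continuous function $h(X)\to[0,\infty)$ if and only if $f$ is slowly oscillating; its Higson corona is the subspace $\nu(X)=h(X)\setminus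 X$. The covering dimension $\dim T$ of a topological space $T$ is the smallest integer $n\ge -1$ such that every finite open cover of $T$ has a finite open refinement covering $T$ of multiplicity at most $n+1$ (and $\infty$ if there is none). A function $f:X\to Y$ of metric spaces is asymptotically Lipschitz if there are constants $M>0$ and $A$ with $d_Y(f(x),f(y))\le M\,d_X(x,y)+A$ for all $x,y\in X$, and proper if preimages of bounded sets are bounded. Dranishnikov's coarse dimension $\dim^c(X)$ is the smallest integer $n\ge -1$ such that for every closed subset $A\subseteq X$ every proper asymptotically Lipschitz function $A\to\mathbb R^{n+1}$ extends to a proper asymptotically Lipschitz function $X\to\mathbb R^{n+1}$ (and $\infty$ if there is none). **Theorem.** Let $X$ be a proper metric space. Then $X$ has a Higson compactification, and for every Higson compactification of $X$ the corresponding Higson corona satisfies $$\dim \nu(X)=\dim^{coa}_{rse}(X).$$ Moreover $\dim^{coa}_{rse}(X)=\dim^c(X)$. -/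

import Mathlib

universe u v

namespace Coarse

open Filter Topology Bornology
open scoped ENNReal NNReal

/-! ### Families of sets -/

/-- `m_𝒰(x)`: the number of elements of `𝒰` containing `x`. -/
noncomputable def multiplicityAt {X : Type u} (𝒰 : Set (Set X)) (x : X) : ℕ∞ :=
  {U | U ∈ 𝒰 ∧ x ∈ U}.encard

/-- The (global) multiplicity of `𝒰`. -/
noncomputable def familyMultiplicity {X : Type u} (𝒰 : Set (Set X)) : ℕ∞ :=
  ⨆ x, multiplicityAt 𝒰 x

/-- `𝒱` refines `𝒰`: every element of `𝒱` is contained in an element of `𝒰`. -/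
def Refines {X : Type u} (𝒱 𝒰 : Set (Set X)) : Prop :=
  ∀ V ∈ 𝒱, ∃ U ∈ 𝒰, V ⊆ U

/-! ### Coarse families and coarse dimension -/

/-- The local Lebesgue number `L_𝒰(x) = sup {dist(x, X \ U) | U ∈ 𝒰} ∈ [0, ∞]`. The distance to
the empty set is `∞`, so the value is `∞` as soon as `X ∈ 𝒰`; for the empty family it is `0`. -/
noncomputable def localLebesgueNumber {X : Type u} [MetricSpace X] (𝒰 : Set (Set X)) (x : X) :
    ℝ≥0∞ :=
  ⨆ U ∈ 𝒰, Metric.infEDist x Uᶜ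

/-- The Lebesgue number `L(𝒰, A) = inf {L_𝒰(x) | x ∈ A}`. -/
noncomputable def lebesgueNumber {X : Type u} [MetricSpace X] (𝒰 : Set (Set X)) (A : Set X) :
    ℝ≥0∞ :=
  ⨅ x ∈ A, localLebesgueNumber 𝒰 x

/-- A family `𝒰` is coarse if `L_𝒰` is coarsely proper: `L_𝒰(x) → ∞` as `x → ∞`, where `x → ∞`
means that `x` leaves every bounded set. -/
def IsCoarseFamily {X : Type u} [MetricSpace X] (𝒰 : Set (Set X)) : Prop :=
  Tendsto (localLebesgueNumber 𝒰) (cobounded X) (𝓝 ∞)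

/-- Every finite coarse family in `X` has a coarse refinement of multiplicity at most `m`. -/
def HasCoarseRefinements (X : Type u) [MetricSpace X] (m : ℕ) : Prop :=
  ∀ 𝒰 : Set (Set X), 𝒰.Finite → IsCoarseFamily 𝒰 →
    ∃ 𝒱 : Set (Set X), IsCoarseFamily 𝒱 ∧ Refines 𝒱 𝒰 ∧ familyMultiplicity 𝒱 ≤ m

/-- The coarse dimension of `X`: the smallest integer `n ≥ -1` such that every finite coarse family
has a coarse refinement of multiplicity at most `n + 1`, and `∞` if there is none.
The index `m` stands for `n + 1`. -/
noncomputable def coarseDim (X : Type u) [MetricSpace X] : EReal :=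
  ⨅ (m : ℕ) (_ : HasCoarseRefinements X m), ((m : EReal) - 1)

/-! ### Covering dimension -/

/-- Every finite open cover of `T` has a finite open refinement that covers `T` and has multiplicity
at most `m`. -/
def HasOpenRefinements (T : Type u) [TopologicalSpace T] (m : ℕ) : Prop :=
  ∀ 𝒰 : Set (Set T), 𝒰.Finite → (∀ U ∈ 𝒰, IsOpen U) → ⋃₀ 𝒰 = Set.univ →
    ∃ 𝒱 : Set (Set T), 𝒱.Finite ∧ (∀ V ∈ 𝒱, IsOpen V) ∧ ⋃₀ 𝒱 = Set.univ ∧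
      Refines 𝒱 𝒰 ∧ familyMultiplicity 𝒱 ≤ m

/-- The covering dimension of a topological space (`-1` exactly for the empty space).
The index `m` stands for `n + 1`. -/
noncomputable def coveringDim (T : Type u) [TopologicalSpace T] : EReal :=
  ⨅ (m : ℕ) (_ : HasOpenRefinements T m), ((m : EReal) - 1)

/-! ### Higson compactification and corona -/

/-- `f : X → Y` is slowly oscillating if `f⁻¹(𝒰)` is coarse for every cover `𝒰` of `Y` of positive
Lebesgue number. -/
def SlowlyOscillating {X : Type u} {Y : Type v} [MetricSpace X] [MetricSpace Y] (f : X → Y) :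
    Prop :=
  ∀ 𝒰 : Set (Set Y), ⋃₀ 𝒰 = Set.univ → 0 < lebesgueNumber 𝒰 Set.univ →
    IsCoarseFamily ((fun U => f ⁻¹' U) '' 𝒰)

/-- `ι : X → H` is a Higson compactification of `X`: `H` is compact Hausdorff, `ι` is an embedding
onto a dense subset, and a bounded continuous function `X → [0, ∞)` extends continuously over `H`
if and only if it is slowly oscillating. -/
structure IsHigsonCompactification {X : Type u} [MetricSpace X] {H : Type v} [TopologicalSpace H]
    (ι : X → H) : Prop where
  compactSpace : CompactSpace H
  t2Space : T2Space H
  isEmbedding : IsEmbedding ι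
  denseRange : DenseRange ι
  extends_iff : ∀ f : X → ℝ≥0, Continuous f → (∃ C : ℝ≥0, ∀ x, f x ≤ C) →
    ((∃ g : H → ℝ≥0, Continuous g ∧ ∀ x, g (ι x) = f x) ↔ SlowlyOscillating f)

/-- The Higson corona `ν(X) = h(X) \ X`, with the subspace topology. -/
abbrev HigsonCorona {X : Type u} {H : Type v} (ι : X → H) : Type v :=
  {p : H // p ∉ Set.range ι}

/-! ### Dranishnikov's coarse dimension -/

/-- `f` is asymptotically Lipschitz: `d(f x, f y) ≤ M d(x, y) + A` for some constants
`M > 0` and `A`. -/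
def AsymptoticallyLipschitz {X : Type u} {Y : Type v} [MetricSpace X] [MetricSpace Y] (f : X → Y) :
    Prop :=
  ∃ M A : ℝ, 0 < M ∧ ∀ x y, dist (f x) (f y) ≤ M * dist x y + A

/-- The morphisms of the asymptotic category: asymptotically Lipschitz maps that are proper, i.e.
such that preimages of bounded sets are bounded. -/
def IsAsymptoticMorphism {X : Type u} {Y : Type v} [MetricSpace X] [MetricSpace Y] (f : X → Y) :
    Prop :=
  AsymptoticallyLipschitz f ∧ ∀ B : Set Y, IsBounded B → IsBounded (f ⁻¹' B)

/-- `Y` is an absolute extensor of the proper metric space `X` in the category of proper metric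
spaces and proper asymptotically Lipschitz maps: every morphism to `Y` from a closed subset of `X`
extends to a morphism from `X`. -/
def IsAbsoluteExtensorOf (Y : Type v) [MetricSpace Y] (X : Type u) [MetricSpace X] : Prop :=
  ∀ (A : Set X), IsClosed A → ∀ f : A → Y, IsAsymptoticMorphism f →
    ∃ g : X → Y, IsAsymptoticMorphism g ∧ ∀ a : A, g a = f a

/-- Dranishnikov's `dim^c(X)`: the smallest integer `n ≥ -1` such that `ℝ^(n+1)` is an absolute
extensor of `X` in the category of proper asymptotically Lipschitz maps, and `∞` if there is none.
The index `m` stands for `n + 1`. -/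
noncomputable def dranishnikovCoarseDim (X : Type u) [MetricSpace X] : EReal :=
  ⨅ (m : ℕ) (_ : IsAbsoluteExtensorOf (EuclideanSpace ℝ (Fin m)) X), ((m : EReal) - 1)

end Coarse

namespace Coarse

open Filter Topology Bornology Uniformity
open scoped ENNReal NNReal

/-! All three dimensions are compared level by level: for each `m`, the refinement property on the
corona, the coarse refinement property on `X` and the extensor property of `ℝ^m` are equivalent, so
the infima agree.

The link between `X` and the corona is the class of bounded slowly oscillating functions, which are
those that extend over `h(X)`. Properness of `X` makes `X` open in `h(X)`. Hence an open set
containing the corona contains all of `X` near infinity (`eventually_mem`), and a closed condition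
that holds near infinity holds on the corona (`compl_range_subset_of_eventually`). A finite coarse
family carries slowly oscillating functions summing to 1 near infinity (`exists_slowOsc_partition`),
and positivity sets of such functions, bounded below somewhere at each point near infinity, form a
coarse family (`isCoarseFamily_range_of_slowOsc`). So covers of the corona and finite coarse
families correspond, and the order is preserved by density of `X` in one direction and by
compactness in the other.

The link with extensors is a third property: a bounded slowly oscillating map to `ℝ^m` can be
changed where its norm is small so as to stay away from 0 near infinity. Coarse refinements of
multiplicity `m` give it by mapping to the nerve and placing the vertices in general position.
Dividing by a growing function turns asymptotically Lipschitz maps into slowly oscillating ones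
(`slowOsc_inv_smul`), and multiplying by a slowly growing scale goes back (`exists_slow_scale`).
Thus extending proper maps and pushing bounded maps off 0 are the same problem. Conversely, pushing
the barycentric coordinates of `m + 1` sets off the barycentre makes their intersection empty, and
finitely many such shrinkings bound the order of any finite family. -/

/-- Slow oscillation of a map into a uniform space: at every scale `R`, the values at points at
distance at most `R` become uniformly close as the points leave all bounded sets. -/
def SlowOsc {X : Type*} [MetricSpace X] {Y : Type*} [UniformSpace Y] (f : X → Y) : Prop :=
  ∀ R : ℝ, Tendsto (fun p : X × X => (f p.1, f p.2))
    (comap Prod.fst (cobounded X) ⊓ 𝓟 {p : X × X | dist p.1 p.2 ≤ R}) (𝓤 Y)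

/-! ### Slow oscillation and its metric reformulations -/

section Basic

variable {X : Type*} [MetricSpace X]

theorem slowOsc_iff {Y : Type*} [PseudoMetricSpace Y] {f : X → Y} :
    SlowOsc f ↔ ∀ R : ℝ, ∀ ε > 0, ∀ᶠ x in cobounded X,
      ∀ y, dist x y ≤ R → dist (f x) (f y) < ε := by
  unfold SlowOsc
  refine forall_congr' fun R => ?_
  rw [Metric.uniformity_basis_dist.tendsto_right_iff]
  refine forall₂_congr fun ε _ => ?_
  rw [eventually_inf_principal, eventually_comap]
  refine eventually_congr (Eventually.of_forall fun x => ?_)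
  constructor
  · intro h y hy
    exact h (x, y) rfl hy
  · rintro h ⟨a, y⟩ rfl hy
    exact h y hy

theorem eventually_forall_dist_le {P : X → Prop} (h : ∀ᶠ x in cobounded X, P x) (R : ℝ) :
    ∀ᶠ x in cobounded X, ∀ y, dist x y ≤ R → P y := by
  have hb : IsBounded {x | ¬ P x} := by
    rw [isBounded_def]
    filter_upwards [h] with x hx hn using hn hx
  have hb' : IsBounded (Metric.cthickening R {x | ¬ P x}) := hb.cthickening
  rw [isBounded_def] at hb'
  filter_upwards [hb'] with x hx y hy
  by_contra hP
  exact hx (Metric.mem_cthickening_of_dist_le x y R _ hP hy)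

theorem isCoarseFamily_iff {𝒰 : Set (Set X)} :
    IsCoarseFamily 𝒰 ↔
      ∀ R : ℝ, ∀ᶠ x in cobounded X, ∃ U ∈ 𝒰, ∀ y, dist x y ≤ R → y ∈ U := by
  unfold IsCoarseFamily
  rw [ENNReal.tendsto_nhds_top_iff_nnreal]
  constructor
  · intro h R
    filter_upwards [h R.toNNReal] with x hx
    unfold localLebesgueNumber at hx
    simp only [lt_iSup_iff] at hx
    obtain ⟨U, hU, hlt⟩ := hx
    refine ⟨U, hU, fun y hy => ?_⟩
    by_contra hyU
    have h1 : Metric.infEDist x Uᶜ ≤ edist x y := Metric.infEDist_le_edist_of_mem hyU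
    have h2 : edist x y ≤ (R.toNNReal : ℝ≥0∞) := by
      rw [edist_dist]
      exact ENNReal.ofReal_le_ofReal hy
    exact absurd hlt (not_lt.2 (h1.trans h2))
  · intro h r
    filter_upwards [h (r + 1)] with x hx
    obtain ⟨U, hU, hball⟩ := hx
    unfold localLebesgueNumber
    have h1 : ((r + 1 : ℝ≥0) : ℝ≥0∞) ≤ Metric.infEDist x Uᶜ := by
      rw [Metric.le_infEDist]
      intro y hy
      by_contra hlt
      push Not at hlt
      refine hy (hball y ?_)
      have : nndist x y < r + 1 := by
        rw [edist_nndist] at hlt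
        exact_mod_cast hlt
      have h3 : dist x y < ((r + 1 : ℝ≥0) : ℝ) := by
        rw [← coe_nndist]; exact_mod_cast this
      push_cast at h3
      exact h3.le
    calc (r : ℝ≥0∞) < ((r + 1 : ℝ≥0) : ℝ≥0∞) := by
          exact_mod_cast lt_add_one r
      _ ≤ _ := h1.trans (le_iSup₂_of_le U hU le_rfl)

/-- One direction tests the definition on the cover by all balls of radius `ε / 2`. In the other, a
positive number below the Lebesgue number of the cover serves as `ε`. -/
theorem slowlyOscillating_iff_slowOsc {Y : Type*} [MetricSpace Y] {f : X → Y} :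
    SlowlyOscillating f ↔ SlowOsc f := by
  rw [slowOsc_iff]
  constructor
  · intro h R ε hε
    have hcov : ⋃₀ (Set.range fun z : Y => Metric.ball z (ε / 2)) = Set.univ := by
      refine Set.eq_univ_of_forall fun z => ?_
      exact Set.mem_sUnion.2 ⟨_, ⟨z, rfl⟩, Metric.mem_ball_self (by positivity)⟩
    have hpos : 0 < lebesgueNumber (Set.range fun z : Y => Metric.ball z (ε / 2)) Set.univ := by
      have : ENNReal.ofReal (ε / 2) ≤
          lebesgueNumber (Set.range fun z : Y => Metric.ball z (ε / 2)) Set.univ := by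
        refine le_iInf₂ fun y _ => ?_
        refine le_iSup₂_of_le (Metric.ball y (ε / 2)) ⟨y, rfl⟩ ?_
        rw [Metric.le_infEDist]
        intro z hz
        rw [edist_dist]
        refine ENNReal.ofReal_le_ofReal ?_
        rw [dist_comm]
        simpa using hz
      exact lt_of_lt_of_le (by simpa using hε) this
    filter_upwards [isCoarseFamily_iff.1 (h _ hcov hpos) (max R 0)] with x hx y hy
    obtain ⟨_, ⟨_, ⟨z, rfl⟩, rfl⟩, hball⟩ := hx
    have h1 : dist (f x) z < ε / 2 := hball x (by simp)
    have h2 : dist (f y) z < ε / 2 := hball y (hy.trans (le_max_left _ _))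
    linarith [dist_triangle_right (f x) (f y) z]
  · intro h 𝒰 _ hpos
    obtain ⟨e, he0, he⟩ := ENNReal.lt_iff_exists_nnreal_btwn.1 hpos
    have he0' : (0 : ℝ) < e := by exact_mod_cast he0
    rw [isCoarseFamily_iff]
    intro R
    filter_upwards [h R e he0'] with x hx
    have h1 : (e : ℝ≥0∞) < localLebesgueNumber 𝒰 (f x) :=
      he.trans_le (iInf₂_le (f x) (Set.mem_univ _))
    unfold localLebesgueNumber at h1
    simp only [lt_iSup_iff] at h1
    obtain ⟨U, hU, hlt⟩ := h1
    refine ⟨_, ⟨U, hU, rfl⟩, fun y hy => ?_⟩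
    by_contra hyU
    have h2 : Metric.infEDist (f x) Uᶜ ≤ edist (f x) (f y) :=
      Metric.infEDist_le_edist_of_mem hyU
    have h3 : edist (f x) (f y) ≤ e := by
      rw [edist_nndist]
      have := hx y hy
      rw [← coe_nndist] at this
      exact_mod_cast this.le
    exact absurd hlt (not_lt.2 (h2.trans h3))

theorem SlowOsc.comp_uniformContinuous {Y Z : Type*} [UniformSpace Y] [UniformSpace Z]
    {f : X → Y} (hf : SlowOsc f) {g : Y → Z} (hg : UniformContinuous g) :
    SlowOsc fun x => g (f x) :=
  fun R => Tendsto.comp hg (hf R)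

theorem slowOsc_pi {ι : Type*} {Y : ι → Type*} [∀ i, UniformSpace (Y i)]
    {f : X → ∀ i, Y i} : SlowOsc f ↔ ∀ i, SlowOsc fun x => f x i := by
  unfold SlowOsc
  simp only [Pi.uniformity, tendsto_iInf, tendsto_comap_iff]
  exact forall_comm

theorem SlowOsc.prodMk {Y Z : Type*} [UniformSpace Y] [UniformSpace Z]
    {f : X → Y} {g : X → Z} (hf : SlowOsc f) (hg : SlowOsc g) :
    SlowOsc fun x => (f x, g x) := by
  intro R
  rw [uniformity_prod, tendsto_inf]
  exact ⟨tendsto_comap_iff.2 (hf R), tendsto_comap_iff.2 (hg R)⟩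

/-- Post-composing a bounded slowly oscillating map into a proper space with a continuous map keeps
it slowly oscillating. -/
theorem SlowOsc.comp_continuous {Y Z : Type*} [PseudoMetricSpace Y] [ProperSpace Y]
    [UniformSpace Z] {f : X → Y} (hf : SlowOsc f) (hb : IsBounded (Set.range f)) {g : Y → Z}
    (hg : Continuous g) : SlowOsc fun x => g (f x) := by
  have hK : IsCompact (closure (Set.range f)) := hb.isCompact_closure
  have hu := hK.uniformContinuousOn_of_continuous hg.continuousOn
  intro R
  refine Tendsto.comp hu (tendsto_inf.2 ⟨hf R, tendsto_principal.2 ?_⟩)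
  exact Eventually.of_forall fun p => ⟨subset_closure ⟨_, rfl⟩, subset_closure ⟨_, rfl⟩⟩

theorem AsymptoticallyLipschitz.of_bound {Y : Type*} [MetricSpace Y] {f : X → Y} {M A : ℝ}
    (h : ∀ x y, dist (f x) (f y) ≤ M * dist x y + A) : AsymptoticallyLipschitz f := by
  refine ⟨max M 1, A, by positivity, fun x y => (h x y).trans ?_⟩
  gcongr
  exact le_max_left _ _

/-- Estimate behind every normalisation below: after multiplication by `s`, the difference of the
quotients is `(u - v) + ((t - s) / t) • v`, so it is controlled by the variation of numerator and
denominator separately. -/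
theorem mul_norm_inv_smul_sub_le {E : Type*} [NormedAddCommGroup E] [NormedSpace ℝ E] {u v : E}
    {s t C : ℝ} (hs : 0 < s) (ht : 0 < t) (hv : ‖v‖ ≤ C * t) :
    s * ‖s⁻¹ • u - t⁻¹ • v‖ ≤ ‖u - v‖ + C * |s - t| := by
  have key : s • (s⁻¹ • u - t⁻¹ • v) = (u - v) + ((t - s) / t) • v := by
    have h1 : (t - s) / t = 1 - s * t⁻¹ := by field_simp
    rw [smul_sub, smul_smul, smul_smul, mul_inv_cancel₀ hs.ne', one_smul, h1, sub_smul, one_smul]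
    abel
  have h2 : ‖((t - s) / t) • v‖ ≤ C * |s - t| := by
    rw [norm_smul, Real.norm_eq_abs, abs_div, abs_of_pos ht, abs_sub_comm]
    calc |s - t| / t * ‖v‖ ≤ |s - t| / t * (C * t) := by gcongr
      _ = C * |s - t| := by field_simp
  calc s * ‖s⁻¹ • u - t⁻¹ • v‖ = ‖s • (s⁻¹ • u - t⁻¹ • v)‖ := by
        rw [norm_smul, Real.norm_eq_abs, abs_of_pos hs]
    _ ≤ _ := by
        rw [key]
        exact (norm_add_le _ _).trans (by gcongr)

/-- The quotient of an asymptotically Lipschitz map by a dominating asymptotically Lipschitz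
function tending to infinity is slowly oscillating. -/
theorem slowOsc_inv_smul {E : Type*} [NormedAddCommGroup E] [NormedSpace ℝ E] {F : X → E}
    {l : X → ℝ} {C : ℝ} (hF : AsymptoticallyLipschitz F) (hl : AsymptoticallyLipschitz l)
    (hpos : ∀ x, 0 < l x) (hFl : ∀ x, ‖F x‖ ≤ C * l x)
    (hlim : Tendsto l (cobounded X) atTop) : SlowOsc fun x => (l x)⁻¹ • F x := by
  obtain ⟨M, A, hM, hF⟩ := hF
  obtain ⟨M', A', hM', hl⟩ := hl
  rw [slowOsc_iff]
  intro R ε hε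
  filter_upwards [hlim.eventually_gt_atTop (((M * R + A) + C * (M' * R + A')) / ε)] with x hx y hy
  have hC : 0 ≤ C := by
    have := (norm_nonneg _).trans (hFl x)
    exact le_of_mul_le_mul_right (by simpa using this) (hpos x)
  have h1 : ‖F x - F y‖ ≤ M * R + A := by
    rw [← dist_eq_norm]
    exact (hF x y).trans (by gcongr)
  have h2 : |l x - l y| ≤ M' * R + A' := by
    rw [← Real.dist_eq]
    exact (hl x y).trans (by gcongr)
  rw [div_lt_iff₀ hε] at hx
  rw [dist_eq_norm]
  refine lt_of_mul_lt_mul_left ?_ (hpos x).le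
  calc _ ≤ ‖F x - F y‖ + C * |l x - l y| := mul_norm_inv_smul_sub_le (hpos x) (hpos y) (hFl y)
    _ ≤ (M * R + A) + C * (M' * R + A') := by gcongr
    _ < l x * ε := hx

end Basic

/-! ### Coarse families and slowly oscillating functions -/

section Families

variable {X : Type*} [MetricSpace X]

/-- A coarse family indexed by a finite type carries a subordinate slowly oscillating family of
functions, which is a partition of unity near infinity. -/
theorem exists_slowOsc_partition {ι : Type*} [Fintype ι] {U : ι → Set X}
    (hU : IsCoarseFamily (Set.range U)) :
    ∃ φ : ι → X → ℝ, (∀ i, Continuous (φ i)) ∧ (∀ i, SlowOsc (φ i)) ∧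
      (∀ i x, 0 ≤ φ i x) ∧ (∀ i x, φ i x ≤ 1) ∧ (∀ i x, φ i x ≠ 0 → x ∈ U i) ∧
      ∀ᶠ x in cobounded X, ∑ i, φ i x = 1 := by
  rcases isEmpty_or_nonempty X with hX | ⟨⟨x0⟩⟩
  · exact ⟨fun _ _ => 0, fun _ => continuous_const, fun _ => slowOsc_iff.2 (by simp), by simp,
      by simp, fun _ x => isEmptyElim x, Eventually.of_forall fun x => isEmptyElim x⟩
  -- The point `x0` keeps the set nonempty, since `infDist` to the empty set is 0 and not `∞`. If `U
  -- i` is all of `X`, the value becomes the distance to `x0`, which still tends to infinity.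
  set d : ι → X → ℝ := fun i x => Metric.infDist x ((U i)ᶜ ∪ {x0}) with hd
  set l : X → ℝ := fun x => max 1 (∑ i, d i x) with hl
  have hne : ∀ i, ((U i)ᶜ ∪ {x0}).Nonempty := fun i => ⟨x0, Or.inr rfl⟩
  have hd0 : ∀ i x, 0 ≤ d i x := fun i x => Metric.infDist_nonneg
  have hdL : ∀ i x y, |d i x - d i y| ≤ dist x y := by
    intro i x y
    have := (Metric.lipschitz_infDist_pt ((U i)ᶜ ∪ {x0})).dist_le_mul x y
    simpa only [Real.dist_eq, NNReal.coe_one, one_mul] using this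
  have hdc : ∀ i, Continuous (d i) := fun i => Metric.continuous_infDist_pt _
  have hlpos : ∀ x, 0 < l x := fun x => lt_of_lt_of_le one_pos (le_max_left _ _)
  have hdl : ∀ i x, d i x ≤ l x := fun i x =>
    (Finset.single_le_sum (f := fun i => d i x) (fun j _ => hd0 j x) (Finset.mem_univ i)).trans
      (le_max_right _ _)
  have hlL : ∀ x y, dist (l x) (l y) ≤ (Fintype.card ι : ℝ) * dist x y + 0 := by
    intro x y
    rw [Real.dist_eq, add_zero]
    refine (abs_max_sub_max_le_max _ _ _ _).trans ?_
    refine max_le (by simp; positivity) ?_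
    rw [← Finset.sum_sub_distrib]
    refine (Finset.abs_sum_le_sum_abs _ _).trans ?_
    refine (Finset.sum_le_sum fun i _ => hdL i x y).trans ?_
    simp
  have hlc : Continuous l := continuous_const.max (continuous_finsetSum _ fun i _ => hdc i)
  have hsum : Tendsto (fun x => ∑ i, d i x) (cobounded X) atTop := by
    rw [tendsto_atTop]
    intro N
    have h0 : ∀ᶠ x in cobounded X, N ≤ dist x x0 := by
      have := Metric.tendsto_dist_right_cobounded_atTop (α := X) x0
      exact this.eventually_ge_atTop N
    filter_upwards [isCoarseFamily_iff.1 hU N, h0] with x hx hx0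
    obtain ⟨_, ⟨i, rfl⟩, hball⟩ := hx
    refine le_trans ?_ (Finset.single_le_sum (f := fun i => d i x) (fun j _ => hd0 j x)
      (Finset.mem_univ i))
    rw [Metric.le_infDist (hne i)]
    rintro y (hy | rfl)
    · by_contra hlt
      exact hy (hball y (not_le.1 hlt).le)
    · exact hx0
  have hlim : Tendsto l (cobounded X) atTop :=
    tendsto_atTop_mono (fun x => le_max_right _ _) hsum
  refine ⟨fun i x => (l x)⁻¹ • d i x, fun i => ?_, fun i => ?_, fun i x => ?_, fun i x => ?_,
    fun i x hx => ?_, ?_⟩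
  · exact (hlc.inv₀ fun x => (hlpos x).ne').smul (hdc i)
  · refine slowOsc_inv_smul (C := 1) (AsymptoticallyLipschitz.of_bound (M := 1) (A := 0) ?_)
      (AsymptoticallyLipschitz.of_bound hlL) hlpos ?_ hlim
    · intro x y
      simpa [Real.dist_eq] using hdL i x y
    · intro x
      rw [Real.norm_eq_abs, abs_of_nonneg (hd0 i x), one_mul]
      exact hdl i x
  · exact mul_nonneg (inv_nonneg.2 (hlpos x).le) (hd0 i x)
  · change (l x)⁻¹ * d i x ≤ 1
    rw [inv_mul_le_iff₀ (hlpos x), mul_one]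
    exact hdl i x
  · by_contra hxU
    refine hx ?_
    have : d i x = 0 := Metric.infDist_zero_of_mem (Or.inl hxU)
    change (l x)⁻¹ • d i x = 0
    rw [this, smul_zero]
  · filter_upwards [hsum.eventually_ge_atTop 1] with x hx
    have : l x = ∑ i, d i x := max_eq_right hx
    rw [← Finset.smul_sum, ← this, smul_eq_mul, inv_mul_cancel₀ (hlpos x).ne']

/-- If `φ i` is at least `δ` at a point far out, slow oscillation keeps it positive on the whole
ball of radius `R` there, and the ball lies in `W i`. -/
theorem isCoarseFamily_range_of_slowOsc {ι : Type*} [Finite ι] {φ : ι → X → ℝ}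
    (hφ : ∀ i, SlowOsc (φ i)) {δ : ℝ} (hδ : 0 < δ)
    (hlow : ∀ᶠ x in cobounded X, ∃ i, δ ≤ φ i x) {W : ι → Set X}
    (hW : ∀ᶠ x in cobounded X, ∀ i, 0 < φ i x → x ∈ W i) :
    IsCoarseFamily (Set.range W) := by
  rw [isCoarseFamily_iff]
  intro R
  have h1 : ∀ᶠ x in cobounded X, ∀ i, ∀ y, dist x y ≤ R → dist (φ i x) (φ i y) < δ :=
    eventually_all.2 fun i => slowOsc_iff.1 (hφ i) R δ hδ
  filter_upwards [h1, hlow, eventually_forall_dist_le hW R] with x h1 ⟨i, hi⟩ h3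
  refine ⟨W i, ⟨i, rfl⟩, fun y hy => h3 y hy i ?_⟩
  have := h1 i y hy
  rw [Real.dist_eq, abs_lt] at this
  linarith

end Families

/-! ### Refinements replaced by shrinkings with the same index set -/

section Shrinking

/-- At most `m` members of the indexed family `W` have a common point. -/
def OrderLE {X ι : Type*} (W : ι → Set X) (m : ℕ) : Prop :=
  ∀ (x : X) (S : Finset ι), (∀ i ∈ S, x ∈ W i) → S.card ≤ m

theorem familyMultiplicity_range_le {X ι : Type*} {W : ι → Set X} {m : ℕ}
    (hW : OrderLE W m) : familyMultiplicity (Set.range W) ≤ m := by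
  classical
  refine iSup_le fun x => ?_
  unfold multiplicityAt
  refine ENat.forall_natCast_le_iff_le.1 fun a ha => ?_
  obtain ⟨t, ht, hta⟩ := Set.exists_subset_encard_eq ha
  have hfin : t.Finite := Set.finite_of_encard_eq_coe hta
  have hch : ∀ V : t, ∃ i, W i = V.1 := fun V => (ht V.2).1
  choose c hc using hch
  have hinj : Function.Injective c := fun V V' h => Subtype.ext (by rw [← hc V, ← hc V', h])
  have := hfin.fintype
  have := hW x (Finset.univ.image c) (by
    intro i hi
    obtain ⟨V, -, rfl⟩ := Finset.mem_image.1 hi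
    rw [hc V]
    exact (ht V.2).2)
  rw [Finset.card_image_of_injective _ hinj, Finset.card_univ] at this
  rw [Set.encard_eq_coe_toFinset_card, Set.toFinset_card] at hta
  have h2 : Fintype.card t = a := by exact_mod_cast hta
  rw [← h2]
  exact_mod_cast this

/-- Amalgamating a refinement of multiplicity at most `m` gives a shrinking of order at most
`m`. -/
theorem Refines.exists_amalgamation {X ι : Type*} {U : ι → Set X} {𝒱 : Set (Set X)}
    (h : Refines 𝒱 (Set.range U)) {m : ℕ} (hm : familyMultiplicity 𝒱 ≤ m) :
    ∃ c : 𝒱 → ι, (∀ V : 𝒱, V.1 ⊆ U (c V)) ∧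
      OrderLE (fun i => ⋃ V : {V : 𝒱 // c V = i}, V.1.1) m := by
  have hch : ∀ V : 𝒱, ∃ i, V.1 ⊆ U i := by
    intro V
    obtain ⟨_, ⟨i, rfl⟩, hi⟩ := h V V.2
    exact ⟨i, hi⟩
  choose c hc using hch
  refine ⟨c, hc, fun x S hS => ?_⟩
  simp only [Set.mem_iUnion] at hS
  choose V hV using hS
  let e : S → {V | V ∈ 𝒱 ∧ x ∈ V} := fun i => ⟨(V i.1 i.2).1.1, (V i.1 i.2).1.2, hV i.1 i.2⟩
  have he : Function.Injective e := by
    intro i j hij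
    have h1 : (V i.1 i.2).1 = (V j.1 j.2).1 := Subtype.ext (congrArg (fun z => z.1) hij)
    have h2 := (V i.1 i.2).2
    rw [h1, (V j.1 j.2).2] at h2
    exact Subtype.ext h2.symm
  have h1 : ENat.card S ≤ ENat.card {V | V ∈ 𝒱 ∧ x ∈ V} := ENat.card_le_card_of_injective he
  have h2 : ENat.card {V | V ∈ 𝒱 ∧ x ∈ V} ≤ m :=
    (le_iSup (multiplicityAt 𝒱) x).trans hm
  have h3 := h1.trans h2
  simp only [ENat.card_eq_coe_fintype_card, Fintype.card_coe] at h3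
  exact_mod_cast h3

variable {X : Type*} [MetricSpace X]

theorem HasCoarseRefinements.exists_shrinking {m : ℕ} (h : HasCoarseRefinements X m)
    {ι : Type*} [Finite ι] {U : ι → Set X} (hU : IsCoarseFamily (Set.range U)) :
    ∃ W : ι → Set X, IsCoarseFamily (Set.range W) ∧ (∀ i, W i ⊆ U i) ∧ OrderLE W m := by
  obtain ⟨𝒱, hcoarse, href, hm⟩ := h _ (Set.finite_range U) hU
  obtain ⟨c, hc, hord⟩ := href.exists_amalgamation hm
  refine ⟨_, ?_, fun i => Set.iUnion_subset ?_, hord⟩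
  · rw [isCoarseFamily_iff] at hcoarse ⊢
    intro R
    filter_upwards [hcoarse R] with x ⟨V, hV, hball⟩
    exact ⟨_, ⟨c ⟨V, hV⟩, rfl⟩, fun y hy => Set.mem_iUnion.2 ⟨⟨⟨V, hV⟩, rfl⟩, hball y hy⟩⟩
  · rintro ⟨V, rfl⟩
    exact hc V

theorem hasCoarseRefinements_of_shrinking {X : Type*} [MetricSpace X] {m : ℕ}
    (h : ∀ 𝒰 : Set (Set X), 𝒰.Finite → IsCoarseFamily (Set.range ((↑) : 𝒰 → Set X)) →
      ∃ W : 𝒰 → Set X, IsCoarseFamily (Set.range W) ∧ (∀ i, W i ⊆ i) ∧ OrderLE W m) :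
    HasCoarseRefinements X m := by
  intro 𝒰 hfin hU
  obtain ⟨W, hcoarse, hsub, hord⟩ := h 𝒰 hfin (by rwa [Subtype.range_coe])
  refine ⟨Set.range W, hcoarse, ?_, familyMultiplicity_range_le hord⟩
  rintro _ ⟨i, rfl⟩
  exact ⟨i, i.2, hsub i⟩

end Shrinking

/-! ### Existence of a Higson compactification -/

section Existence

/-- The bounded continuous slowly oscillating functions, which generate the Higson
compactification. -/
def IsHigsonFunction {X : Type*} [MetricSpace X] (f : X → ℝ≥0) : Prop :=
  Continuous f ∧ (∃ C : ℝ≥0, ∀ x, f x ≤ C) ∧ SlowOsc f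

variable {X : Type*} [MetricSpace X]

/-- Tent functions vanish near infinity. They separate points from closed sets, which makes the
evaluation map an embedding, and they detect that `X` is open in its compactification. -/
theorem isHigsonFunction_bump (x₀ : X) (ε : ℝ) :
    IsHigsonFunction fun x => Real.toNNReal (ε - dist x x₀) := by
  refine ⟨by fun_prop, ⟨ε.toNNReal, fun x => ?_⟩, slowOsc_iff.2 fun R δ hδ => ?_⟩
  · exact Real.toNNReal_le_toNNReal (by linarith [dist_nonneg (x := x) (y := x₀)])
  · have h0 : ∀ᶠ x in cobounded X, ε + |R| ≤ dist x x₀ :=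
      (Metric.tendsto_dist_right_cobounded_atTop x₀).eventually_ge_atTop _
    filter_upwards [h0] with x hx y hy
    have h1 : ε - dist x x₀ ≤ 0 := by linarith [abs_nonneg R]
    have h2 : ε - dist y x₀ ≤ 0 := by linarith [le_abs_self R, dist_triangle x y x₀]
    rw [Real.toNNReal_of_nonpos h1, Real.toNNReal_of_nonpos h2, dist_self]
    exact hδ

/-- The evaluation map into the product of half-lines indexed by the Higson functions. -/
def higsonEval (X : Type*) [MetricSpace X] (x : X) :
    {f : X → ℝ≥0 // IsHigsonFunction f} → ℝ≥0 :=
  fun f => f.1 x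

theorem isEmbedding_higsonEval : IsEmbedding (higsonEval X) := by
  refine IsInducing.isEmbedding (isInducing_iff_nhds.2 fun x => le_antisymm ?_ ?_)
  · have hc : Continuous (higsonEval X) := continuous_pi fun f => f.2.1
    exact hc.continuousAt.tendsto.le_comap
  · rw [Metric.nhds_basis_ball.ge_iff]
    intro ε hε
    refine ⟨{p | 0 < p ⟨_, isHigsonFunction_bump x ε⟩}, ?_, fun y hy => ?_⟩
    · refine IsOpen.mem_nhds (isOpen_lt continuous_const (continuous_apply _)) ?_
      simpa [higsonEval] using hε
    · have : 0 < Real.toNNReal (ε - dist y x) := hy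
      rw [Real.toNNReal_pos] at this
      exact Metric.mem_ball.2 (by linarith)

/-- The canonical map of `X` into the closure of the image of `higsonEval`. -/
def toHigson (X : Type*) [MetricSpace X] (x : X) : closure (Set.range (higsonEval X)) :=
  ⟨higsonEval X x, subset_closure ⟨x, rfl⟩⟩

theorem isHigsonCompactification_toHigson : IsHigsonCompactification (toHigson X) := by
  have hcompact : CompactSpace (closure (Set.range (higsonEval X))) := by
    choose C hC using fun f : {f : X → ℝ≥0 // IsHigsonFunction f} => f.2.2.1
    have hK : IsCompact (Set.univ.pi fun f => Set.Icc 0 (C f)) :=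
      isCompact_univ_pi fun f => isCompact_Icc
    refine isCompact_iff_compactSpace.1 (hK.of_isClosed_subset isClosed_closure ?_)
    refine closure_minimal ?_ hK.isClosed
    rintro _ ⟨x, rfl⟩ f -
    exact ⟨zero_le, hC f x⟩
  -- The embedding itself oscillates slowly for the product uniformity, because each coordinate
  -- does. A continuous function on the compact closure is uniformly continuous, so its restriction
  -- to `X` inherits this; conversely a Higson function extends as a coordinate projection.
  have hslow : SlowOsc (toHigson X) := by
    have h1 : SlowOsc (higsonEval X) := slowOsc_pi.2 fun f => f.2.2.2
    intro R
    rw [uniformity_subtype, tendsto_comap_iff]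
    exact h1 R
  refine ⟨hcompact, inferInstance, ?_, ?_, fun f hf hb => ⟨?_, fun h => ?_⟩⟩
  · exact isEmbedding_higsonEval.codRestrict _ _
  · refine Subtype.dense_iff.2 (closure_mono ?_)
    rintro _ ⟨x, rfl⟩
    exact ⟨toHigson X x, ⟨x, rfl⟩, rfl⟩
  · rintro ⟨g, hg, hgf⟩
    have h1 := hslow.comp_uniformContinuous (CompactSpace.uniformContinuous_of_continuous hg)
    rw [slowlyOscillating_iff_slowOsc]
    exact (funext hgf) ▸ h1
  · exact ⟨fun p => p.1 ⟨f, hf, hb, slowlyOscillating_iff_slowOsc.1 h⟩,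
      (continuous_apply _).comp continuous_subtype_val, fun x => rfl⟩

end Existence

/-! ### Covering dimension of the corona equals coarse dimension -/

namespace IsHigsonCompactification

variable {X H : Type*} [MetricSpace X] [TopologicalSpace H] {ι : X → H}

theorem exists_extension (h : IsHigsonCompactification ι) {φ : X → ℝ} (hc : Continuous φ)
    (hs : SlowOsc φ) (h0 : ∀ x, 0 ≤ φ x) {C : ℝ} (hC : ∀ x, φ x ≤ C) :
    ∃ g : H → ℝ, Continuous g ∧ (∀ p, 0 ≤ g p) ∧ ∀ x, g (ι x) = φ x := by
  have hs' : SlowOsc fun x => Real.toNNReal (φ x) :=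
    hs.comp_uniformContinuous Real.lipschitzWith_toNNReal.uniformContinuous
  obtain ⟨g, hg, hgφ⟩ := (h.extends_iff (fun x => Real.toNNReal (φ x)) (by fun_prop)
    ⟨C.toNNReal, fun x => Real.toNNReal_le_toNNReal (hC x)⟩).2
    (slowlyOscillating_iff_slowOsc.2 hs')
  refine ⟨fun p => g p, by fun_prop, fun p => (g p).2, fun x => ?_⟩
  simp only [hgφ]
  exact Real.coe_toNNReal _ (h0 x)

theorem slowOsc_comp (h : IsHigsonCompactification ι) {g : H → ℝ} (hg : Continuous g)
    (h0 : ∀ p, 0 ≤ g p) : SlowOsc fun x => g (ι x) := by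
  have := h.compactSpace
  obtain ⟨C, hC⟩ := (isCompact_range hg).bddAbove
  have hcont : Continuous fun x => Real.toNNReal (g (ι x)) := by
    have := h.isEmbedding.continuous
    fun_prop
  have h1 : SlowOsc fun x => Real.toNNReal (g (ι x)) := by
    refine slowlyOscillating_iff_slowOsc.1 ((h.extends_iff _ hcont ⟨C.toNNReal, fun x => ?_⟩).1
      ⟨fun p => Real.toNNReal (g p), by fun_prop, fun x => rfl⟩)
    exact Real.toNNReal_le_toNNReal (hC ⟨_, rfl⟩)
  have h2 := h1.comp_uniformContinuous NNReal.isometry_coe.uniformContinuous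
  have h3 : (fun x => g (ι x)) = fun x => ((g (ι x)).toNNReal : ℝ) :=
    funext fun x => (Real.coe_toNNReal _ (h0 _)).symm
  rw [h3]
  exact h2

/-- By density, the extension of a tent function can be positive only in the closure of its support
in `X`; that support lies in a closed ball, which is compact and hence closed in `H`. -/
theorem isOpen_range [ProperSpace X] (h : IsHigsonCompactification ι) :
    IsOpen (Set.range ι) := by
  have := h.t2Space
  rw [isOpen_iff_mem_nhds]
  rintro _ ⟨x, rfl⟩
  have hφ := isHigsonFunction_bump x 1
  obtain ⟨g, hg, hgφ⟩ := (h.extends_iff _ hφ.1 hφ.2.1).2 (slowlyOscillating_iff_slowOsc.2 hφ.2.2)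
  have hopen : IsOpen {p | 0 < g p} := isOpen_lt continuous_const hg
  have hK : IsClosed (ι '' Metric.closedBall x 1) :=
    ((isCompact_closedBall x 1).image h.isEmbedding.continuous).isClosed
  have hsub : {p | 0 < g p} ⊆ ι '' Metric.closedBall x 1 := by
    refine (h.denseRange.open_subset_closure_inter hopen).trans (closure_minimal ?_ hK)
    rintro _ ⟨hp, y, rfl⟩
    refine ⟨y, ?_, rfl⟩
    have h1 : 0 < g (ι y) := hp
    rw [hgφ, Real.toNNReal_pos] at h1
    exact Metric.mem_closedBall.2 (by linarith)
  refine mem_of_superset (hopen.mem_nhds ?_) (hsub.trans (Set.image_subset_range _ _))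
  change 0 < g (ι x)
  rw [hgφ]
  simp

/-- The complement of `O` is compact and lies in the image of `X`, so its preimage is compact, hence
bounded. -/
theorem eventually_mem [ProperSpace X] (h : IsHigsonCompactification ι) {O : Set H}
    (hO : IsOpen O) (hsub : (Set.range ι)ᶜ ⊆ O) : ∀ᶠ x in cobounded X, ι x ∈ O := by
  have := h.compactSpace
  have hK : IsCompact (ι ⁻¹' Oᶜ) := by
    rw [h.isEmbedding.isInducing.isCompact_preimage_iff (Set.compl_subset_comm.1 hsub)]
    exact hO.isClosed_compl.isCompact
  have := hK.isBounded
  rw [isBounded_def] at this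
  filter_upwards [this] with x hx
  exact not_not.1 hx

theorem compl_range_subset_of_eventually [ProperSpace X] (h : IsHigsonCompactification ι)
    {Z : Set H} (hZ : IsClosed Z) (hev : ∀ᶠ x in cobounded X, ι x ∈ Z) :
    (Set.range ι)ᶜ ⊆ Z := by
  have := h.t2Space
  have hB : IsBounded {x | ι x ∉ Z} := by
    rw [isBounded_def]
    filter_upwards [hev] with x hx hn using hn hx
  have hK : IsClosed (ι '' closure {x | ι x ∉ Z}) :=
    (hB.isCompact_closure.image h.isEmbedding.continuous).isClosed
  have huniv : closure (Set.range ι) ⊆ ι '' closure {x | ι x ∉ Z} ∪ Z := by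
    refine closure_minimal ?_ (hK.union hZ)
    rintro _ ⟨x, rfl⟩
    by_cases hx : ι x ∈ Z
    · exact Or.inr hx
    · exact Or.inl ⟨x, subset_closure hx, rfl⟩
  intro p hp
  rcases huniv (h.denseRange p) with ⟨x, -, rfl⟩ | hpZ
  · exact absurd ⟨x, rfl⟩ hp
  · exact hpZ

/-- Finitely many relatively open sets covering the corona support a finite family of continuous
functions on the compactification that is a partition of unity on the corona. -/
theorem exists_partition [ProperSpace X] (h : IsHigsonCompactification ι) {κ : Type*} [Fintype κ]
    {O : κ → Set (HigsonCorona ι)} (hO : ∀ j, IsOpen (O j)) (hcov : ⋃ j, O j = Set.univ) :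
    ∃ f : κ → H → ℝ, (∀ j, Continuous (f j)) ∧ (∀ j p, 0 ≤ f j p) ∧
      (∀ j (p : HigsonCorona ι), (p : H) ∈ closure {q | f j q ≠ 0} → p ∈ O j) ∧
      ∀ p : HigsonCorona ι, ∑ j, f j p = 1 := by
  have := h.compactSpace
  have := h.t2Space
  have hcl : IsClosed (Set.range ι)ᶜ := h.isOpen_range.isClosed_compl
  choose O' hO' hOO' using fun j => isOpen_induced_iff.1 (hO j)
  obtain ⟨f, hf⟩ := PartitionOfUnity.exists_isSubordinate hcl O' hO' (fun p hp => by
    have : (⟨p, hp⟩ : HigsonCorona ι) ∈ ⋃ j, O j := hcov ▸ Set.mem_univ _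
    obtain ⟨j, hj⟩ := Set.mem_iUnion.1 this
    rw [← hOO' j] at hj
    exact Set.mem_iUnion.2 ⟨j, hj⟩)
  refine ⟨fun j => f j, fun j => (f j).continuous, fun j p => f.nonneg j p, fun j p hp => ?_,
    fun p => ?_⟩
  · rw [← hOO' j]
    exact hf j hp
  · rw [← f.sum_eq_one p.2, finsum_eq_sum_of_fintype]

/-- A partition of unity for the cover, extended to `H`, restricts to a coarse family on `X`. This
is shrunk to order `m`, and the partition functions of the shrinking extend back to `H`; their
positivity sets on the corona form the refinement. -/
theorem hasOpenRefinements_corona [ProperSpace X] (h : IsHigsonCompactification ι) {m : ℕ}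
    (hX : HasCoarseRefinements X m) : HasOpenRefinements (HigsonCorona ι) m := by
  have := h.compactSpace
  have := h.t2Space
  intro 𝒰 hfin hopen hcov
  have := hfin.fintype
  obtain ⟨f, hfc, hf0, hfO, hfsum⟩ := h.exists_partition (O := fun U : 𝒰 => U.1)
    (fun U => hopen U U.2) (by rw [← Set.sUnion_eq_iUnion, hcov])
  have hcoarse : IsCoarseFamily (Set.range fun U : 𝒰 => {x | 0 < f U (ι x)}) := by
    -- If every function were below this value, the sum would be at most `1 / 2`, while it is close
    -- to 1 near the corona. The `+ 1` covers the empty family.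
    have hN : (0 : ℝ) < 1 / (2 * (Fintype.card 𝒰 + 1)) := by positivity
    refine isCoarseFamily_range_of_slowOsc (φ := fun U x => f U (ι x))
      (fun U => h.slowOsc_comp (hfc U) (hf0 U)) hN ?_ (Eventually.of_forall fun x U hx => hx)
    have hsub := h.eventually_mem (O := {p | 1 / 2 < ∑ U, f U p})
      (isOpen_lt continuous_const (continuous_finsetSum _ fun U _ => hfc U)) (fun p hp => by
        have := hfsum ⟨p, hp⟩
        change 1 / 2 < ∑ U, f U p
        rw [this]
        norm_num)
    filter_upwards [hsub] with x hx
    by_contra hcon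
    push Not at hcon
    have h1 : ∑ U, f U (ι x) ≤ ∑ _U : 𝒰, 1 / (2 * ((Fintype.card 𝒰 : ℝ) + 1)) :=
      Finset.sum_le_sum fun U _ => (hcon U).le
    rw [Finset.sum_const, Finset.card_univ, nsmul_eq_mul, mul_one_div] at h1
    have h2 : (Fintype.card 𝒰 : ℝ) / (2 * ((Fintype.card 𝒰 : ℝ) + 1)) ≤ 1 / 2 := by
      rw [div_le_div_iff₀ (by positivity) (by positivity)]
      linarith
    exact absurd (lt_of_lt_of_le hx h1) (not_lt.2 h2)
  obtain ⟨W, hW, hWU, hord⟩ := hX.exists_shrinking hcoarse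
  obtain ⟨ψ, hψc, hψs, hψ0, hψ1, hψW, hψsum⟩ := exists_slowOsc_partition hW
  choose g hgc hg0 hgψ using fun U => h.exists_extension (hψc U) (hψs U) (hψ0 U) (hψ1 U)
  have hgclosure : ∀ U : 𝒰, ∀ p, 0 < g U p → p ∈ closure (ι '' W U) := by
    intro U p hp
    have hop : IsOpen {q | 0 < g U q} := isOpen_lt continuous_const (hgc U)
    refine closure_mono ?_ (h.denseRange.open_subset_closure_inter hop hp)
    rintro _ ⟨hq, x, rfl⟩
    refine ⟨x, hψW U x ?_, rfl⟩
    rw [← hgψ]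
    exact (show 0 < g U (ι x) from hq).ne'
  refine ⟨Set.range fun U : 𝒰 => {p : HigsonCorona ι | 0 < g U p}, Set.finite_range _, ?_, ?_, ?_,
    familyMultiplicity_range_le ?_⟩
  · rintro _ ⟨U, rfl⟩
    exact isOpen_lt continuous_const ((hgc U).comp continuous_subtype_val)
  · refine Set.eq_univ_of_forall fun p => ?_
    have hsum : (Set.range ι)ᶜ ⊆ {p | ∑ U, g U p = 1} :=
      h.compl_range_subset_of_eventually
        (isClosed_eq (continuous_finsetSum _ fun U _ => hgc U) continuous_const) (by
          filter_upwards [hψsum] with x hx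
          simpa only [Set.mem_ofPred_eq, hgψ] using hx)
    have h1 : ∑ U, g U p = 1 := hsum p.2
    obtain ⟨U, -, hU⟩ := Finset.exists_ne_zero_of_sum_ne_zero (by rw [h1]; exact one_ne_zero)
    exact Set.mem_sUnion.2 ⟨_, ⟨U, rfl⟩, lt_of_le_of_ne (hg0 U p) hU.symm⟩
  · rintro _ ⟨U, rfl⟩
    refine ⟨U, U.2, fun p hp => hfO U p ?_⟩
    refine closure_mono ?_ (hgclosure U p hp)
    rintro _ ⟨x, hx, rfl⟩
    exact (show 0 < f U (ι x) from hWU U hx).ne'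
  -- The functions indexed by `S` are simultaneously positive on an open set of `H`, which by
  -- density contains a point of `X`. That point lies in all `W U` with `U ∈ S`, so the order bound
  -- on `X` applies.
  · intro p S hS
    have hop : IsOpen {q | 0 < ∏ U ∈ S, g U q} :=
      isOpen_lt continuous_const (continuous_finsetProd _ fun U _ => hgc U)
    obtain ⟨x, hx⟩ := h.denseRange.exists_mem_open hop
      ⟨(p : H), show 0 < ∏ U ∈ S, g U p from Finset.prod_pos hS⟩
    refine hord x S fun U hU => hψW U x ?_
    rw [← hgψ]
    exact (Finset.prod_ne_zero_iff.1 (show 0 < ∏ U ∈ S, g U (ι x) from hx).ne') U hU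

theorem hasCoarseRefinements_of_corona [ProperSpace X] (h : IsHigsonCompactification ι) {m : ℕ}
    (hν : HasOpenRefinements (HigsonCorona ι) m) : HasCoarseRefinements X m := by
  have := h.compactSpace
  have := h.t2Space
  refine hasCoarseRefinements_of_shrinking fun 𝒰 hfin hU => ?_
  have := hfin.fintype
  obtain ⟨φ, hφc, hφs, hφ0, hφ1, hφU, hφsum⟩ := exists_slowOsc_partition hU
  choose g hgc hg0 hgφ using fun U => h.exists_extension (hφc U) (hφs U) (hφ0 U) (hφ1 U)
  have hgsum : (Set.range ι)ᶜ ⊆ {p | ∑ U, g U p = 1} :=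
    h.compl_range_subset_of_eventually
      (isClosed_eq (continuous_finsetSum _ fun U _ => hgc U) continuous_const) (by
        filter_upwards [hφsum] with x hx
        simpa only [Set.mem_ofPred_eq, hgφ] using hx)
  have hopen : ∀ U : 𝒰, IsOpen {p : HigsonCorona ι | 0 < g U p} := fun U =>
    isOpen_lt continuous_const ((hgc U).comp continuous_subtype_val)
  obtain ⟨𝒱, -, hVopen, hVcov, hVref, hVm⟩ := hν
    (Set.range fun U : 𝒰 => {p : HigsonCorona ι | 0 < g U p}) (Set.finite_range _)
    (by rintro _ ⟨U, rfl⟩; exact hopen U) (by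
      refine Set.eq_univ_of_forall fun p => ?_
      have h1 : ∑ U, g U p = 1 := hgsum p.2
      obtain ⟨U, -, hU⟩ := Finset.exists_ne_zero_of_sum_ne_zero (by rw [h1]; exact one_ne_zero)
      exact Set.mem_sUnion.2 ⟨_, ⟨U, rfl⟩, lt_of_le_of_ne (hg0 U p) hU.symm⟩)
  obtain ⟨c, hc, hord⟩ := hVref.exists_amalgamation hVm
  set O : 𝒰 → Set (HigsonCorona ι) := fun U => ⋃ V : {V : 𝒱 // c V = U}, V.1.1 with hOdef
  have hOopen : ∀ U, IsOpen (O U) := fun U => isOpen_iUnion fun V => hVopen _ V.1.2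
  have hOcov : ⋃ U, O U = Set.univ := by
    refine Set.eq_univ_of_forall fun p => ?_
    obtain ⟨V, hV, hp⟩ := Set.mem_sUnion.1 (hVcov ▸ Set.mem_univ p)
    exact Set.mem_iUnion.2 ⟨c ⟨V, hV⟩, Set.mem_iUnion.2 ⟨⟨⟨V, hV⟩, rfl⟩, hp⟩⟩
  have hOg : ∀ U, ∀ p ∈ O U, 0 < g U p := by
    intro U p hp
    obtain ⟨⟨V, rfl⟩, hV⟩ := Set.mem_iUnion.1 hp
    exact hc V hV
  obtain ⟨f, hfc, hf0, hfO, hfsum⟩ := h.exists_partition hOopen hOcov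
  -- In the product, `g U` confines the support on `X` to the original set `U`, and `f U` confines
  -- it on the corona to `O U`, where the order is at most `m`.
  have hχc : ∀ U, Continuous fun p => f U p * g U p := fun U => (hfc U).mul (hgc U)
  have hχ0 : ∀ U p, 0 ≤ f U p * g U p := fun U p => mul_nonneg (hf0 U p) (hg0 U p)
  have hsumc : Continuous fun p => ∑ U, f U p * g U p := continuous_finsetSum _ fun U _ => hχc U
  obtain ⟨δ, hδ, hδle⟩ : ∃ δ, 0 < δ ∧ ∀ p ∈ (Set.range ι)ᶜ, δ ≤ ∑ U, f U p * g U p := by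
    refine h.isOpen_range.isClosed_compl.isCompact.exists_forall_le' hsumc.continuousOn ?_
    intro p hp
    have h1 := hfsum ⟨p, hp⟩
    obtain ⟨U, -, hU⟩ := Finset.exists_ne_zero_of_sum_ne_zero (by rw [h1]; exact one_ne_zero)
    refine Finset.sum_pos' (fun U _ => hχ0 U p) ⟨U, Finset.mem_univ U, ?_⟩
    exact mul_pos (lt_of_le_of_ne (hf0 U p) (Ne.symm hU)) (hOg U ⟨p, hp⟩ (hfO U _ (subset_closure hU)))
  set η : ℝ := δ / (4 * (Fintype.card 𝒰 + 1)) with hη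
  have hηpos : 0 < η := by positivity
  have hbig : ∀ᶠ x in cobounded X, ∃ U, η ≤ f U (ι x) * g U (ι x) - η := by
    have hsub := h.eventually_mem (O := {p | δ / 2 < ∑ U, f U p * g U p})
      (isOpen_lt continuous_const hsumc) (fun p hp => by
        have := hδle p hp
        change δ / 2 < ∑ U, f U p * g U p
        linarith)
    filter_upwards [hsub] with x hx
    by_contra hcon
    push Not at hcon
    have h1 : ∑ U, f U (ι x) * g U (ι x) ≤ ∑ _U : 𝒰, 2 * η :=
      Finset.sum_le_sum fun U _ => by linarith [hcon U]
    rw [Finset.sum_const, Finset.card_univ, nsmul_eq_mul] at h1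
    have h2 : (Fintype.card 𝒰 : ℝ) * (2 * η) ≤ δ / 2 := by
      have h3 : ((Fintype.card 𝒰 : ℝ) + 1) * (2 * η) = δ / 2 := by
        rw [hη]; field_simp; norm_num
      nlinarith
    exact absurd (lt_of_lt_of_le hx h1) (not_lt.2 h2)
  have hinter : ∀ᶠ x in cobounded X, ∀ S : Finset 𝒰, (∀ U ∈ S, η < f U (ι x) * g U (ι x)) →
      S.card ≤ m := by
    refine eventually_all.2 fun S => ?_
    by_cases hS : S.card ≤ m
    · exact Eventually.of_forall fun _ _ => hS
    -- A corona point of this closed set would lie in more than `m` of the sets `O U`. So the set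
    -- misses the corona, and its trace on `X` is bounded.
    have hclosed : IsClosed {p | ∀ U ∈ S, η ≤ f U p * g U p} := by
      simp only [Set.ofPred_forall]
      exact isClosed_biInter fun U _ => isClosed_le continuous_const (hχc U)
    have hsub := h.eventually_mem hclosed.isOpen_compl (fun p hp hpS => by
      refine hS (hord ⟨p, hp⟩ S fun U hU => hfO U _ (subset_closure ?_))
      intro h0
      have := hpS U hU
      rw [h0, zero_mul] at this
      linarith)
    filter_upwards [hsub] with x hx hcon
    exact absurd (fun U hU => (hcon U hU).le) hx
  -- The order is controlled only near infinity. Deleting the bounded exceptional set leaves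
  -- coarseness intact.
  set B : Set X := {x | ¬ ∀ S : Finset 𝒰, (∀ U ∈ S, η < f U (ι x) * g U (ι x)) → S.card ≤ m}
  refine ⟨fun U => {x | η < f U (ι x) * g U (ι x)} \ B, ?_, fun U x hx => ?_, ?_⟩
  · refine isCoarseFamily_range_of_slowOsc (φ := fun U x => f U (ι x) * g U (ι x) - η)
      (fun U => ?_) hηpos hbig ?_
    · exact (h.slowOsc_comp (hχc U) (hχ0 U)).comp_uniformContinuous
        (uniformContinuous_id.sub uniformContinuous_const)
    · filter_upwards [hinter] with x hx U hU
      exact ⟨sub_pos.1 hU, not_not.2 hx⟩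
  · refine hφU U x ?_
    rw [← hgφ]
    intro h0
    have h1 : η < f U (ι x) * g U (ι x) := hx.1
    rw [h0, mul_zero] at h1
    linarith
  · intro x S hS
    by_cases hx : x ∈ B
    · rcases S.eq_empty_or_nonempty with rfl | ⟨U, hU⟩
      · simp
      · exact absurd hx (hS U hU).2
    · exact not_not.1 hx S fun U hU => (hS U hU).1

theorem coveringDim_corona [ProperSpace X] (h : IsHigsonCompactification ι) :
    coveringDim (HigsonCorona ι) = coarseDim X := by
  unfold coveringDim coarseDim
  refine iInf_congr fun m => iInf_congr_Prop ?_ fun _ => rfl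
  exact ⟨h.hasCoarseRefinements_of_corona, h.hasOpenRefinements_corona⟩

end IsHigsonCompactification

/-! ### Linear general position -/

section GeneralPosition

open Module

variable {E : Type*} [NormedAddCommGroup E] [NormedSpace ℝ E]

/-- Proper subspaces are null for Haar measure, and so is a finite union of them, while balls have
positive measure. -/
theorem exists_dist_lt_notMem_iUnion_submodule [FiniteDimensional ℝ E] {κ : Type*} [Finite κ] {V : κ → Submodule ℝ E}
    (hV : ∀ k, V k ≠ ⊤) (c : E) {ε : ℝ} (hε : 0 < ε) :
    ∃ v, dist v c < ε ∧ ∀ k, v ∉ V k := by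
  let _ : MeasurableSpace E := borel E
  have : BorelSpace E := ⟨rfl⟩
  let μ : MeasureTheory.Measure E := MeasureTheory.Measure.addHaar
  have h0 : μ (⋃ k, (V k : Set E)) = 0 := MeasureTheory.measure_iUnion_null fun k =>
    MeasureTheory.Measure.addHaar_submodule μ (V k) (hV k)
  have hpos : 0 < μ (Metric.ball c ε) := Metric.measure_ball_pos μ c hε
  have hns : ¬ Metric.ball c ε ⊆ ⋃ k, (V k : Set E) := fun hsub =>
    absurd (MeasureTheory.measure_mono_null hsub h0) hpos.ne'
  obtain ⟨v, hv, hv'⟩ := Set.not_subset.1 hns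
  exact ⟨v, hv, fun k hk => hv' (Set.mem_iUnion.2 ⟨k, hk⟩)⟩

/-- Finitely many points can be moved by less than `ε` into linearly general position. -/
theorem exists_dist_lt_linearIndepOn [FiniteDimensional ℝ E] {κ : Type*} [Finite κ] (c : κ → E) {ε : ℝ} (hε : 0 < ε) :
    ∃ p : κ → E, (∀ i, dist (p i) (c i) < ε) ∧
      ∀ S : Finset κ, S.card ≤ finrank ℝ E → LinearIndepOn ℝ p (S : Set κ) := by
  classical
  have := Fintype.ofFinite κ
  suffices H : ∀ T : Finset κ, ∃ p : κ → E, (∀ i, dist (p i) (c i) < ε) ∧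
      ∀ S ⊆ T, S.card ≤ finrank ℝ E → LinearIndepOn ℝ p (S : Set κ) by
    obtain ⟨p, hp, hS⟩ := H Finset.univ
    exact ⟨p, hp, fun S => hS S (Finset.subset_univ S)⟩
  intro T
  induction T using Finset.induction_on with
  | empty =>
    refine ⟨c, fun i => by simp [hε], fun S hS _ => ?_⟩
    rw [Finset.subset_empty.1 hS, Finset.coe_empty]
    exact linearIndepOn_empty ℝ c
  | insert a T ha ih =>
    obtain ⟨p, hp, hind⟩ := ih
    obtain ⟨v, hvc, hv⟩ := exists_dist_lt_notMem_iUnion_submodule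
      (κ := {S : Finset κ // S.card < finrank ℝ E})
      (V := fun S => Submodule.span ℝ (S.1.image p : Set E)) (fun S htop => by
        have h1 := finrank_span_finset_le_card (R := ℝ) (S.1.image p)
        rw [Set.finrank, htop, finrank_top] at h1
        exact absurd (h1.trans Finset.card_image_le) (not_le.2 S.2)) (c a) hε
    refine ⟨Function.update p a v, fun i => ?_, fun S hS hcard => ?_⟩
    · rcases eq_or_ne i a with rfl | hi
      · rwa [Function.update_self]
      · simpa [Function.update_of_ne hi] using hp i
    · have hcongr : ∀ R : Finset κ, a ∉ R → Set.EqOn p (Function.update p a v) (R : Set κ) :=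
        fun R hR i hi => (Function.update_of_ne (fun h => hR (by simpa [h] using hi)) _ _).symm
      by_cases haS : a ∈ S
      · have hsub : S.erase a ⊆ T := by
          rwa [← Finset.subset_insert_iff]
        have hlt : (S.erase a).card < finrank ℝ E :=
          (Finset.card_erase_lt_of_mem haS).trans_le hcard
        have hna : a ∉ S.erase a := Finset.notMem_erase a S
        rw [← Finset.insert_erase haS, Finset.coe_insert,
          linearIndepOn_insert (by simp)]
        refine ⟨(hind _ hsub hlt.le).congr (hcongr _ hna), ?_⟩
        rw [← (hcongr _ hna).image_eq, Function.update_self]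
        have := hv ⟨S.erase a, hlt⟩
        rwa [Finset.coe_image] at this
      · refine (hind S ?_ hcard).congr (hcongr S haS)
        intro i hi
        rcases Finset.mem_insert.1 (hS hi) with rfl | h
        · exact absurd hi haS
        · exact h

/-- If any `m` of the points `p i` are linearly independent, then the convex combinations of at
most `m` of them stay away from the origin. -/
theorem exists_le_norm_sum_smul {κ : Type*} [Fintype κ] {p : κ → E} {m : ℕ}
    (hp : ∀ S : Finset κ, S.card ≤ m → LinearIndepOn ℝ p (S : Set κ)) :
    ∃ δ > 0, ∀ w : κ → ℝ, (∀ i, 0 ≤ w i) → ∑ i, w i = 1 →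
      (∀ S : Finset κ, (∀ i ∈ S, w i ≠ 0) → S.card ≤ m) → δ ≤ ‖∑ i, w i • p i‖ := by
  classical
  -- `K S` is the face of the simplex spanned by `S`. The faces with at most `m` vertices have a
  -- compact union, on which the norm is positive by independence and so bounded below.
  set K : Finset κ → Set (κ → ℝ) := fun S => stdSimplex ℝ κ ∩ {w | ∀ i ∉ S, w i = 0}
  have hK : ∀ S, IsCompact (K S) := fun S => by
    refine (isCompact_stdSimplex ℝ κ).inter_right ?_
    simp only [Set.ofPred_forall]
    exact isClosed_iInter fun i => isClosed_iInter fun _ =>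
      isClosed_eq (continuous_apply i) continuous_const
  have hKu : IsCompact (⋃ S ∈ {S : Finset κ | S.card ≤ m}, K S) :=
    (Set.toFinite _).isCompact_biUnion fun S _ => hK S
  obtain ⟨δ, hδ, hle⟩ := hKu.exists_forall_le' (f := fun w => ‖∑ i, w i • p i‖) (a := 0)
    (by fun_prop) (by
      intro w hw
      simp only [Set.mem_iUnion] at hw
      obtain ⟨S, hS, hwS, hw0⟩ := hw
      refine norm_pos_iff.2 fun hzero => ?_
      have h1 : ∑ i ∈ S, w i • p i = 0 := by
        rw [← hzero]
        exact Finset.sum_subset (Finset.subset_univ S) fun i _ hi => by rw [hw0 i hi, zero_smul]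
      have h2 := linearIndepOn_finset_iff.1 (hp S hS) w h1
      have h3 : ∑ i, w i = 0 := Finset.sum_eq_zero fun i _ => by
        by_cases hi : i ∈ S
        · exact h2 i hi
        · exact hw0 i hi
      have h4 : ∑ i, w i = 1 := hwS.2
      rw [h3] at h4
      exact zero_ne_one h4)
  refine ⟨δ, hδ, fun w hw0 hw1 hwS => hle w ?_⟩
  simp only [Set.mem_iUnion]
  refine ⟨Finset.univ.filter fun i => w i ≠ 0, hwS _ (by simp), ⟨hw0, hw1⟩, ?_⟩
  intro i hi
  simpa using hi

end GeneralPosition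

/-! ### Pushing bounded slowly oscillating maps off the origin -/

section Perturbation

open Module

variable {X : Type*} [MetricSpace X] {E : Type*} [NormedAddCommGroup E] [NormedSpace ℝ E]
  [FiniteDimensional ℝ E]

/-- Balls covering the range pull back to a coarse family, which is shrunk to order `m`. Sending the
index `c` to a point `p c` near the centre `c`, in general position, and interpolating by the
partition gives convex combinations of at most `m` independent vectors, which stay away from 0. The
error `3 * ε` is the radius `2 * ε` plus the displacement `ε`. -/
theorem HasCoarseRefinements.exists_approximation {m : ℕ} (h : HasCoarseRefinements X m)
    (hm : m ≤ finrank ℝ E) {F : X → E} (hF : SlowOsc F) {C : ℝ} (hC : ∀ x, ‖F x‖ ≤ C) {ε : ℝ}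
    (hε : 0 < ε) : ∃ g : X → E, SlowOsc g ∧ (∃ C', ∀ x, ‖g x‖ ≤ C') ∧ ∃ δ > 0,
      ∀ᶠ x in cobounded X, dist (g x) (F x) ≤ 3 * ε ∧ δ ≤ ‖g x‖ := by
  obtain ⟨t, -, htfin, hcov⟩ := (isCompact_closedBall (0 : E) C).finite_cover_balls hε
  have := htfin.fintype
  have hcoarse : IsCoarseFamily (Set.range fun c : t => {x | dist (F x) c < 2 * ε}) := by
    have hs : ∀ c : t, SlowOsc fun x => 2 * ε - dist (F x) c := fun c =>
      hF.comp_uniformContinuous (g := fun v : E => 2 * ε - dist v c)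
        (uniformContinuous_const.sub (uniformContinuous_id.dist uniformContinuous_const))
    refine isCoarseFamily_range_of_slowOsc hs hε (Eventually.of_forall fun x => ?_)
      (Eventually.of_forall fun x c hx => ?_)
    · have := hcov (mem_closedBall_zero_iff.2 (hC x))
      simp only [Set.mem_iUnion] at this
      obtain ⟨c, hc, hx⟩ := this
      exact ⟨⟨c, hc⟩, by linarith [Metric.mem_ball.1 hx]⟩
    · exact sub_pos.1 hx
  obtain ⟨W, hW, hWU, hord⟩ := h.exists_shrinking hcoarse
  obtain ⟨φ, -, hφs, hφ0, hφ1, hφW, hφsum⟩ := exists_slowOsc_partition hW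
  obtain ⟨p, hpc, hp⟩ := exists_dist_lt_linearIndepOn (fun c : t => (c : E)) hε
  obtain ⟨δ, hδ, hδle⟩ := exists_le_norm_sum_smul (m := m) fun S hS => hp S (hS.trans hm)
  refine ⟨fun x => ∑ c, φ c x • p c, ?_, ⟨∑ c, ‖p c‖, fun x => ?_⟩, δ, hδ, ?_⟩
  · have h1 : SlowOsc fun x => fun c => φ c x := slowOsc_pi.2 hφs
    refine h1.comp_continuous ?_ (g := fun w : t → ℝ => ∑ c, w c • p c) (by fun_prop)
    refine isBounded_iff_forall_norm_le.2 ⟨1, ?_⟩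
    rintro _ ⟨x, rfl⟩
    refine (pi_norm_le_iff_of_nonneg zero_le_one).2 fun c => ?_
    rw [Real.norm_eq_abs, abs_of_nonneg (hφ0 c x)]
    exact hφ1 c x
  · refine (norm_sum_le _ _).trans (Finset.sum_le_sum fun c _ => ?_)
    rw [norm_smul, Real.norm_eq_abs, abs_of_nonneg (hφ0 c x)]
    exact mul_le_of_le_one_left (norm_nonneg _) (hφ1 c x)
  · filter_upwards [hφsum] with x hx
    refine ⟨?_, hδle _ (fun c => hφ0 c x) hx fun S hS => hord x S fun c hc => hφW c x (hS c hc)⟩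
    have h1 : (∑ c, φ c x • p c) - F x = ∑ c, φ c x • (p c - F x) := by
      simp only [smul_sub, Finset.sum_sub_distrib, ← Finset.sum_smul, hx, one_smul]
    rw [dist_eq_norm, h1]
    calc ‖∑ c, φ c x • (p c - F x)‖ ≤ ∑ c, φ c x * (3 * ε) := by
          refine (norm_sum_le _ _).trans (Finset.sum_le_sum fun c _ => ?_)
          rw [norm_smul, Real.norm_eq_abs, abs_of_nonneg (hφ0 c x)]
          by_cases hc : φ c x = 0
          · simp [hc]
          · have h2 : dist (F x) c < 2 * ε := hWU c (hφW c x hc)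
            rw [← dist_eq_norm]
            have h3 := dist_triangle (p c) c (F x)
            rw [dist_comm (c : E)] at h3
            exact mul_le_mul_of_nonneg_left (by linarith [hpc c]) (hφ0 c x)
      _ = 3 * ε := by rw [← Finset.sum_mul, hx, one_mul]

/-- The piecewise linear function that is `0` up to `ε / 2` and `1` from `ε` on. -/
noncomputable def cutoff (ε t : ℝ) : ℝ := max 0 (min 1 (2 * t / ε - 1))

theorem cutoff_nonneg (ε t : ℝ) : 0 ≤ cutoff ε t := le_max_left _ _

theorem cutoff_le_one (ε t : ℝ) : cutoff ε t ≤ 1 := max_le zero_le_one (min_le_left _ _)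

theorem cutoff_of_le {ε t : ℝ} (hε : 0 < ε) (h : ε ≤ t) : cutoff ε t = 1 := by
  have : 1 ≤ 2 * t / ε - 1 := by
    rw [le_sub_iff_add_le, le_div_iff₀ hε]
    linarith
  rw [cutoff, min_eq_left this, max_eq_right zero_le_one]

theorem cutoff_of_le_half {ε t : ℝ} (hε : 0 < ε) (h : t ≤ ε / 2) : cutoff ε t = 0 := by
  have : 2 * t / ε - 1 ≤ 0 := by
    rw [sub_nonpos, div_le_iff₀ hε]
    linarith
  exact max_eq_left ((min_le_right _ _).trans this)

theorem abs_cutoff_sub_le {ε : ℝ} (hε : 0 < ε) (s t : ℝ) :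
    |cutoff ε s - cutoff ε t| ≤ 2 / ε * |s - t| := by
  have h0 : 0 ≤ 2 / ε * |s - t| := by positivity
  refine (abs_max_sub_max_le_max _ _ _ _).trans (max_le (by simpa using h0) ?_)
  refine (abs_min_sub_min_le_max _ _ _ _).trans (max_le (by simpa using h0) ?_)
  rw [show 2 * s / ε - 1 - (2 * t / ε - 1) = 2 / ε * (s - t) by ring, abs_mul,
    abs_of_pos (by positivity : (0 : ℝ) < 2 / ε)]

theorem continuous_cutoff (ε : ℝ) : Continuous (cutoff ε) := by
  unfold cutoff
  fun_prop

theorem HasCoarseRefinements.exists_perturbation {m : ℕ} (h : HasCoarseRefinements X m)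
    (hm : m ≤ finrank ℝ E) {F : X → E} (hF : SlowOsc F) {C : ℝ} (hC : ∀ x, ‖F x‖ ≤ C) {ε : ℝ}
    (hε : 0 < ε) : ∃ g : X → E, SlowOsc g ∧ (∃ C', ∀ x, ‖g x‖ ≤ C') ∧ ∃ δ > 0,
      ∀ᶠ x in cobounded X, (ε ≤ ‖F x‖ → g x = F x) ∧ δ ≤ ‖g x‖ := by
  obtain ⟨g, hg, ⟨C', hC'⟩, δ, hδ, hev⟩ :=
    -- This makes the approximation error `ε / 4`. Where `‖F x‖ > ε / 2` the blend then has norm at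
    -- least `ε / 4`; where `‖F x‖ ≤ ε / 2` the blend is the approximation itself.
    h.exists_approximation hm hF hC (ε := ε / 12) (by positivity)
  refine ⟨fun x => (1 - cutoff ε ‖F x‖) • g x + cutoff ε ‖F x‖ • F x, ?_, ⟨C' + C, fun x => ?_⟩,
    min δ (ε / 4), by positivity, ?_⟩
  · refine (hF.prodMk hg).comp_continuous ?_
      (g := fun q : E × E => (1 - cutoff ε ‖q.1‖) • q.2 + cutoff ε ‖q.1‖ • q.1) ?_
    · refine isBounded_iff_forall_norm_le.2 ⟨max C C', ?_⟩
      rintro _ ⟨x, rfl⟩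
      exact max_le_max (hC x) (hC' x)
    · have := continuous_cutoff ε
      fun_prop
  · have h0 := cutoff_nonneg ε ‖F x‖
    have h1 := cutoff_le_one ε ‖F x‖
    refine (norm_add_le _ _).trans (add_le_add ?_ ?_)
    · rw [norm_smul, Real.norm_eq_abs, abs_of_nonneg (by linarith)]
      exact (mul_le_of_le_one_left (norm_nonneg _) (by linarith)).trans (hC' x)
    · rw [norm_smul, Real.norm_eq_abs, abs_of_nonneg h0]
      exact (mul_le_of_le_one_left (norm_nonneg _) h1).trans (hC x)
  · filter_upwards [hev] with x ⟨hdist, hlow⟩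
    have h0 := cutoff_nonneg ε ‖F x‖
    have h1 := cutoff_le_one ε ‖F x‖
    have hd : dist ((1 - cutoff ε ‖F x‖) • g x + cutoff ε ‖F x‖ • F x) (F x) ≤ ε / 4 := by
      have : (1 - cutoff ε ‖F x‖) • g x + cutoff ε ‖F x‖ • F x - F x =
          (1 - cutoff ε ‖F x‖) • (g x - F x) := by module
      rw [dist_eq_norm, this, norm_smul, Real.norm_eq_abs, abs_of_nonneg (by linarith),
        ← dist_eq_norm]
      exact (mul_le_of_le_one_left dist_nonneg (by linarith)).trans (by linarith)
    refine ⟨fun hle => by simp [cutoff_of_le hε hle], ?_⟩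
    rcases le_or_gt ‖F x‖ (ε / 2) with hle | hlt
    · simpa [cutoff_of_le_half hε hle] using Or.inl hlow
    · refine (min_le_right _ _).trans ?_
      have := norm_sub_norm_le (F x) ((1 - cutoff ε ‖F x‖) • g x + cutoff ε ‖F x‖ • F x)
      rw [← dist_eq_norm, dist_comm] at this
      linarith

end Perturbation

/-! ### Slowly growing scales -/

section SlowGrowth

variable {X : Type*} [MetricSpace X]

theorem exists_one_le_tendsto_cobounded (X : Type*) [MetricSpace X] :
    ∃ b : X → ℝ, (∀ x, 1 ≤ b x) ∧ Tendsto b (cobounded X) atTop := by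
  rcases isEmpty_or_nonempty X with hX | ⟨⟨x₀⟩⟩
  · exact ⟨fun _ => 1, fun _ => le_rfl, tendsto_atTop.2 fun _ =>
      Eventually.of_forall fun x => isEmptyElim x⟩
  · exact ⟨fun x => max 1 (dist x x₀), fun x => le_max_left _ _,
      tendsto_atTop_mono (fun x => le_max_right _ _)
        (Metric.tendsto_dist_right_cobounded_atTop x₀)⟩

/-- A function tending to infinity has a `1`-Lipschitz minorant tending to infinity. -/
theorem exists_lipschitz_minorant {a : X → ℝ} {c : ℝ} (hc : 0 ≤ c) (ha : ∀ x, c ≤ a x)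
    (hlim : Tendsto a (cobounded X) atTop) :
    ∃ r : X → ℝ, (∀ x, c ≤ r x) ∧ (∀ x, r x ≤ a x) ∧ (∀ x y, |r x - r y| ≤ dist x y) ∧
      Tendsto r (cobounded X) atTop := by
  have hbdd : ∀ x, BddBelow (Set.range fun z => a z + dist x z) := fun x => by
    refine ⟨c, ?_⟩
    rintro _ ⟨z, rfl⟩
    exact (ha z).trans (le_add_of_nonneg_right dist_nonneg)
  have hle : ∀ x y, (⨅ z, (a z + dist x z)) ≤ (⨅ z, (a z + dist y z)) + dist x y := by
    intro x y
    have : Nonempty X := ⟨x⟩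
    rw [← sub_le_iff_le_add]
    refine le_ciInf fun z => ?_
    have := ciInf_le (hbdd x) z
    linarith [dist_triangle x y z]
  -- Infimal convolution with the metric: terms with `z` near `x` are large because `a` is large
  -- there, the others because `dist x z` is.
  refine ⟨fun x => ⨅ z, (a z + dist x z), fun x => ?_, fun x => ?_, fun x y => ?_, ?_⟩
  · have : Nonempty X := ⟨x⟩
    exact le_ciInf fun z => (ha z).trans (le_add_of_nonneg_right dist_nonneg)
  · simpa using ciInf_le (hbdd x) x
  · have h1 := hle x y
    have h2 := hle y x
    rw [dist_comm y x] at h2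
    exact abs_sub_le_iff.2 ⟨by linarith, by linarith⟩
  · rw [tendsto_atTop]
    intro N
    filter_upwards [eventually_forall_dist_le (hlim.eventually_ge_atTop N) N] with x hx
    have : Nonempty X := ⟨x⟩
    refine le_ciInf fun z => ?_
    rcases le_or_gt (dist x z) N with h | h
    · exact (hx z h).trans (le_add_of_nonneg_right dist_nonneg)
    · linarith [ha z]

/-- A bounded slowly oscillating map admits scales `r` growing so slowly that `r • G` is
asymptotically Lipschitz. -/
theorem exists_slow_scale {Y : Type*} [PseudoMetricSpace Y] {G : X → Y} (hG : SlowOsc G) {D : ℝ}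
    (hD : ∀ x y, dist (G x) (G y) ≤ D) {b : X → ℝ} (hb : ∀ x, 1 ≤ b x)
    (hlim : Tendsto b (cobounded X) atTop) :
    ∃ r : X → ℝ, (∀ x, 0 < r x) ∧ (∀ x, r x ≤ b x) ∧ (∀ x y, |r x - r y| ≤ dist x y) ∧
      Tendsto r (cobounded X) atTop ∧ ∀ x y, r x * dist (G x) (G y) ≤ 1 + dist x y := by
  -- A scale below all `q x y` satisfies the required bound. The summand `1 / b x` keeps the
  -- denominator positive, and since `q x x = b x` it also forces `r ≤ b`.
  set q : X → X → ℝ := fun x y => (1 + dist x y) / (dist (G x) (G y) + 1 / b x) with hq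
  have hbpos : ∀ x, 0 < b x := fun x => one_pos.trans_le (hb x)
  have hden : ∀ x y, 0 < dist (G x) (G y) + 1 / b x := fun x y =>
    add_pos_of_nonneg_of_pos dist_nonneg (one_div_pos.2 (hbpos x))
  have hden' : ∀ x y, dist (G x) (G y) + 1 / b x ≤ |D| + 1 := fun x y =>
    add_le_add ((hD x y).trans (le_abs_self D)) (by
      rw [div_le_one (hbpos x)]
      exact hb x)
  have hD1 : 0 < |D| + 1 := by positivity
  have hqc : ∀ x y, 1 / (|D| + 1) ≤ q x y := fun x y => by
    refine div_le_div₀ (by positivity) ?_ (hden x y) (hden' x y)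
    linarith [dist_nonneg (x := x) (y := y)]
  have hbdd : ∀ x, BddBelow (Set.range (q x)) := fun x => by
    refine ⟨1 / (|D| + 1), ?_⟩
    rintro _ ⟨y, rfl⟩
    exact hqc x y
  have hatend : Tendsto (fun x => ⨅ y, q x y) (cobounded X) atTop := by
    rw [tendsto_atTop]
    intro N
    have hN : 0 < max N 1 := lt_of_lt_of_le one_pos (le_max_right _ _)
    filter_upwards [slowOsc_iff.1 hG (max N 1 * (|D| + 1)) (1 / (2 * max N 1)) (by positivity),
      hlim.eventually_ge_atTop (2 * max N 1)] with x h1 h2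
    have : Nonempty X := ⟨x⟩
    refine (le_max_left N 1).trans (le_ciInf fun y => ?_)
    rw [hq, le_div_iff₀ (hden x y)]
    -- For `y` near `x` slow oscillation makes the denominator small; for `y` far away the numerator
    -- outgrows the bounded denominator.
    rcases le_or_gt (dist x y) (max N 1 * (|D| + 1)) with h | h
    · have h3 : 1 / b x ≤ 1 / (2 * max N 1) := one_div_le_one_div_of_le (by positivity) h2
      calc max N 1 * (dist (G x) (G y) + 1 / b x)
          ≤ max N 1 * (1 / (2 * max N 1) + 1 / (2 * max N 1)) := by
            gcongr
            exact (h1 y h).le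
        _ = 1 := by field_simp; norm_num
        _ ≤ 1 + dist x y := le_add_of_nonneg_right dist_nonneg
    · calc max N 1 * (dist (G x) (G y) + 1 / b x) ≤ max N 1 * (|D| + 1) :=
            mul_le_mul_of_nonneg_left (hden' x y) hN.le
        _ ≤ 1 + dist x y := by linarith
  obtain ⟨r, hrc, hra, hrL, hrlim⟩ := exists_lipschitz_minorant (c := 1 / (|D| + 1))
    (by positivity) (fun x => by
      have : Nonempty X := ⟨x⟩
      exact le_ciInf fun y => hqc x y) hatend
  have hrq : ∀ x y, r x ≤ q x y := fun x y => (hra x).trans (ciInf_le (hbdd x) y)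
  refine ⟨r, fun x => lt_of_lt_of_le (by positivity) (hrc x), fun x => ?_, hrL, hrlim,
    fun x y => ?_⟩
  · simpa [hq] using hrq x x
  · have h1 := hrq x y
    rw [hq, le_div_iff₀ (hden x y)] at h1
    refine le_trans ?_ h1
    have : 0 ≤ r x := (by positivity : (0 : ℝ) ≤ 1 / (|D| + 1)).trans (hrc x)
    gcongr
    exact le_add_of_nonneg_right (one_div_nonneg.2 (hbpos x).le)

end SlowGrowth

/-! ### Calculus of asymptotically Lipschitz maps -/

section AsymptoticallyLipschitz

variable {X : Type*} [MetricSpace X] {E : Type*} [NormedAddCommGroup E]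

theorem AsymptoticallyLipschitz.add {F G : X → E} (hF : AsymptoticallyLipschitz F)
    (hG : AsymptoticallyLipschitz G) : AsymptoticallyLipschitz fun x => F x + G x := by
  obtain ⟨M, A, hM, hF⟩ := hF
  obtain ⟨M', A', hM', hG⟩ := hG
  refine ⟨M + M', A + A', by positivity, fun x y => (dist_add_add_le _ _ _ _).trans ?_⟩
  linarith [hF x y, hG x y]

theorem AsymptoticallyLipschitz.of_dist_le {Y : Type*} [MetricSpace Y] {F G : X → Y}
    (hF : AsymptoticallyLipschitz F) {C : ℝ} (hC : ∀ x, dist (F x) (G x) ≤ C) :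
    AsymptoticallyLipschitz G := by
  obtain ⟨M, A, hM, hF⟩ := hF
  refine ⟨M, A + 2 * C, hM, fun x y => ?_⟩
  have h1 := dist_triangle4 (G x) (F x) (F y) (G y)
  rw [dist_comm (G x) (F x)] at h1
  linarith [hC x, hC y, hF x y]

theorem AsymptoticallyLipschitz.max {F G : X → ℝ} (hF : AsymptoticallyLipschitz F)
    (hG : AsymptoticallyLipschitz G) : AsymptoticallyLipschitz fun x => max (F x) (G x) := by
  obtain ⟨M, A, hM, hF⟩ := hF
  obtain ⟨M', A', hM', hG⟩ := hG
  refine ⟨M + M', Max.max A A', by positivity, fun x y => ?_⟩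
  rw [Real.dist_eq]
  refine (abs_max_sub_max_le_max _ _ _ _).trans (max_le ?_ ?_)
  · rw [← Real.dist_eq]
    nlinarith [hF x y, le_max_left A A', dist_nonneg (x := x) (y := y)]
  · rw [← Real.dist_eq]
    nlinarith [hG x y, le_max_right A A', dist_nonneg (x := x) (y := y)]

theorem AsymptoticallyLipschitz.min {F G : X → ℝ} (hF : AsymptoticallyLipschitz F)
    (hG : AsymptoticallyLipschitz G) : AsymptoticallyLipschitz fun x => min (F x) (G x) := by
  obtain ⟨M, A, hM, hF⟩ := hF
  obtain ⟨M', A', hM', hG⟩ := hG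
  refine ⟨M + M', Max.max A A', by positivity, fun x y => ?_⟩
  rw [Real.dist_eq]
  refine (abs_min_sub_min_le_max _ _ _ _).trans (max_le ?_ ?_)
  · rw [← Real.dist_eq]
    nlinarith [hF x y, le_max_left A A', dist_nonneg (x := x) (y := y)]
  · rw [← Real.dist_eq]
    nlinarith [hG x y, le_max_right A A', dist_nonneg (x := x) (y := y)]

theorem AsymptoticallyLipschitz.of_lipschitz {r : X → ℝ} (hr : ∀ x y, |r x - r y| ≤ dist x y) :
    AsymptoticallyLipschitz r :=
  AsymptoticallyLipschitz.of_bound (M := 1) (A := 0) fun x y => by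
    simpa [Real.dist_eq] using hr x y

theorem AsymptoticallyLipschitz.norm_div {F : X → E} (hF : AsymptoticallyLipschitz F) {c : ℝ}
    (hc : 0 < c) : AsymptoticallyLipschitz fun x => ‖F x‖ / c := by
  obtain ⟨M, A, hM, hF⟩ := hF
  refine ⟨M / c, A / c, by positivity, fun x y => ?_⟩
  rw [Real.dist_eq, ← sub_div, abs_div, abs_of_pos hc, div_mul_eq_mul_div, ← add_div]
  gcongr
  exact (abs_norm_sub_norm_le _ _).trans (by simpa [dist_eq_norm] using hF x y)

variable [NormedSpace ℝ E]

theorem asymptoticallyLipschitz_smul {r : X → ℝ} {G : X → E} (hr0 : ∀ x, 0 < r x)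
    (hr : ∀ x y, |r x - r y| ≤ dist x y) {C : ℝ} (hC : ∀ x, ‖G x‖ ≤ C)
    (hrG : ∀ x y, r x * dist (G x) (G y) ≤ 1 + dist x y) :
    AsymptoticallyLipschitz fun x => r x • G x := by
  refine AsymptoticallyLipschitz.of_bound (M := 1 + C) (A := 1) fun x y => ?_
  have : r x • G x - r y • G y = r x • (G x - G y) + (r x - r y) • G y := by module
  rw [dist_eq_norm, this]
  refine (norm_add_le _ _).trans ?_
  rw [norm_smul, norm_smul, Real.norm_eq_abs, Real.norm_eq_abs, abs_of_pos (hr0 x),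
    ← dist_eq_norm]
  have h1 : |r x - r y| * ‖G y‖ ≤ dist x y * C :=
    mul_le_mul (hr x y) (hC y) (norm_nonneg _) dist_nonneg
  linarith [hrG x y]

end AsymptoticallyLipschitz

/-! ### Coarse refinements make `ℝ^m` an absolute extensor -/

section Extension

variable {X : Type*} [MetricSpace X]

/-- McShane's infimum is `M`-Lipschitz but agrees with `f` on `A` only up to `C`. Overwriting it by
`f` on `A` costs a bounded error, which the conclusion allows. -/
theorem exists_extension_real {A : Set X} {f : A → ℝ} {M C : ℝ} (hM : 0 ≤ M) (hC : 0 ≤ C)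
    (hf : ∀ a b, |f a - f b| ≤ M * dist a b + C) :
    ∃ F : X → ℝ, (∀ x y, |F x - F y| ≤ M * dist x y + 2 * C) ∧ ∀ a : A, F a = f a := by
  classical
  rcases isEmpty_or_nonempty A with hA | hA
  · exact ⟨fun _ => 0, fun x y => by simp; positivity, fun a => isEmptyElim a⟩
  have hlow : ∀ (x : X) (a b : A), f b - C - M * dist x b ≤ f a + M * dist x a := by
    intro x a b
    have h1 := (abs_le.1 (hf b a)).2
    have h2 : M * dist b a ≤ M * (dist x b + dist x a) := by
      gcongr
      exact dist_triangle_left (b : X) a x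
    linarith
  have hbdd : ∀ x : X, BddBelow (Set.range fun a : A => f a + M * dist x a) := fun x => by
    obtain ⟨b⟩ := hA
    refine ⟨f b - C - M * dist x b, ?_⟩
    rintro _ ⟨a, rfl⟩
    exact hlow x a b
  set F₀ : X → ℝ := fun x => ⨅ a : A, (f a + M * dist x a) with hF₀
  have hle : ∀ x y, F₀ x ≤ F₀ y + M * dist x y := by
    intro x y
    rw [← sub_le_iff_le_add]
    refine le_ciInf fun a => ?_
    have h1 := ciInf_le (hbdd x) a
    have h2 : M * dist x a ≤ M * (dist x y + dist y a) := by
      gcongr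
      exact dist_triangle _ _ _
    linarith
  have hnear : ∀ a : A, F₀ a ≤ f a ∧ f a ≤ F₀ a + C := fun a => by
    constructor
    · simpa using ciInf_le (hbdd a) a
    · rw [← sub_le_iff_le_add]
      refine le_ciInf fun b => ?_
      have := hlow a b a
      rw [dist_self] at this
      linarith
  set F : X → ℝ := fun x => if h : x ∈ A then f ⟨x, h⟩ else F₀ x with hF
  have hFF : ∀ x, F₀ x ≤ F x ∧ F x ≤ F₀ x + C := fun x => by
    by_cases hx : x ∈ A
    · simp only [hF, hx, dite_true]
      exact hnear ⟨x, hx⟩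
    · simp only [hF, hx, dite_false]
      exact ⟨le_rfl, by linarith⟩
  refine ⟨F, fun x y => ?_, fun a => by simp [hF]⟩
  have h1 := hle x y
  have h2 := hle y x
  rw [dist_comm y x] at h2
  have h3 := hFF x
  have h4 := hFF y
  exact abs_sub_le_iff.2 ⟨by linarith, by linarith⟩

theorem norm_le_sum_abs {κ : Type*} [Fintype κ] (v : EuclideanSpace ℝ κ) : ‖v‖ ≤ ∑ i, |v i| := by
  classical
  have h : v = ∑ i, v i • (EuclideanSpace.single i (1 : ℝ)) := by
    ext j
    simp [Pi.single_apply]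
  calc ‖v‖ = ‖∑ i, v i • (EuclideanSpace.single i (1 : ℝ))‖ := congrArg norm h
    _ ≤ ∑ i, ‖v i • (EuclideanSpace.single i (1 : ℝ))‖ := norm_sum_le _ _
    _ = ∑ i, |v i| := by simp [norm_smul]

theorem AsymptoticallyLipschitz.exists_extension {A : Set X} {m : ℕ}
    {f : A → EuclideanSpace ℝ (Fin m)} (hf : AsymptoticallyLipschitz f) :
    ∃ F : X → EuclideanSpace ℝ (Fin m), AsymptoticallyLipschitz F ∧ ∀ a : A, F a = f a := by
  obtain ⟨M, C, hM, hf⟩ := hf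
  have h1 : ∀ i : Fin m, ∀ a b, |f a i - f b i| ≤ M * dist a b + |C| := fun i a b => by
    have h2 := PiLp.norm_apply_le (f a - f b) i
    rw [← dist_eq_norm] at h2
    exact h2.trans ((hf a b).trans (by gcongr; exact le_abs_self C))
  choose F hF hFf using fun i : Fin m => exists_extension_real hM.le (abs_nonneg C) (h1 i)
  refine ⟨fun x => WithLp.toLp 2 fun i => F i x, ?_, fun a => ?_⟩
  · refine AsymptoticallyLipschitz.of_bound (M := m * M) (A := m * (2 * |C|)) fun x y => ?_
    rw [dist_eq_norm]
    refine (norm_le_sum_abs _).trans ((Finset.sum_le_sum fun i _ => hF i x y).trans_eq ?_)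
    simp
    ring
  · ext i
    exact hFf i a

variable {E : Type*} [NormedAddCommGroup E]

theorem eventually_le_norm_of_proper {A : Set X} {f : A → E}
    (hf : ∀ B : Set E, IsBounded B → IsBounded (f ⁻¹' B)) (N : ℝ) :
    ∀ᶠ x in cobounded X, ∀ hx : x ∈ A, N ≤ ‖f ⟨x, hx⟩‖ := by
  have h1 := isBounded_image_subtype_val.2 (hf _ (Metric.isBounded_ball (x := (0 : E)) (r := N)))
  rw [isBounded_def] at h1
  filter_upwards [h1] with x hx hxA
  by_contra hlt
  exact hx ⟨⟨x, hxA⟩, mem_ball_zero_iff.2 (not_le.1 hlt), rfl⟩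

theorem isBounded_preimage_of_tendsto {g : X → E}
    (hg : Tendsto (fun x => ‖g x‖) (cobounded X) atTop) (B : Set E) (hB : IsBounded B) :
    IsBounded (g ⁻¹' B) := by
  obtain ⟨N, hN⟩ := isBounded_iff_forall_norm_le.1 hB
  rw [isBounded_def]
  filter_upwards [hg.eventually_gt_atTop N] with x hx hxB
  exact absurd (hN _ hxB) (not_le.2 hx)

/-- The asymptotically Lipschitz extension `F` may fail to be proper. Its normalisation `G = F / l`
oscillates slowly and has norm 1 on `A` apart from points where `F` is bounded, so it can be pushed
off 0 without changing it where `‖G‖ ≥ 1 / 2`. The result is scaled back by `l` where `G` has norm 1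
and by a slow scale `r` where `G` is small, with a blend between. -/
theorem HasCoarseRefinements.isAbsoluteExtensorOf {X : Type*} [MetricSpace X] {m : ℕ}
    (h : HasCoarseRefinements X m) : IsAbsoluteExtensorOf (EuclideanSpace ℝ (Fin m)) X := by
  classical
  rintro A - f ⟨hfL, hfp⟩
  obtain ⟨F, hF, hFf⟩ := hfL.exists_extension
  obtain ⟨b₀, hb₀, hb₀lim⟩ := exists_one_le_tendsto_cobounded X
  -- On `A` this gives `r₁ ≤ ‖F‖` except where `‖F‖ < 1`, and there `r₁ ≤ 1`. Properness of `f`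
  -- makes the majorant tend to infinity.
  obtain ⟨r₁, hr₁1, hr₁b, hr₁L, hr₁lim⟩ := exists_lipschitz_minorant zero_le_one
    (a := fun x => if x ∈ A then max 1 ‖F x‖ else b₀ x) (fun x => by
      by_cases hx : x ∈ A
      · simp [hx]
      · simpa [hx] using hb₀ x) (by
      rw [tendsto_atTop]
      intro N
      filter_upwards [hb₀lim.eventually_ge_atTop N, eventually_le_norm_of_proper hfp N]
        with x h1 h2
      by_cases hx : x ∈ A
      · simp only [hx, if_true]
        refine le_max_of_le_right ?_
        have := h2 hx
        rwa [← hFf] at this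
      · simpa [hx] using h1)
  set l : X → ℝ := fun x => max (r₁ x) ‖F x‖ with hl
  have hr₁pos : ∀ x, 0 < r₁ x := fun x => one_pos.trans_le (hr₁1 x)
  have hlpos : ∀ x, 0 < l x := fun x => (hr₁pos x).trans_le (le_max_left _ _)
  have hFl : ∀ x, ‖F x‖ ≤ 1 * l x := fun x => by
    rw [one_mul]
    exact le_max_right _ _
  have hlL : AsymptoticallyLipschitz l := by
    have := (AsymptoticallyLipschitz.of_lipschitz hr₁L).max (hF.norm_div one_pos)
    simpa using this
  set G : X → EuclideanSpace ℝ (Fin m) := fun x => (l x)⁻¹ • F x with hG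
  have hGs : SlowOsc G := slowOsc_inv_smul hF hlL hlpos hFl
    (tendsto_atTop_mono (fun x => le_max_left _ _) hr₁lim)
  have hGn : ∀ x, ‖G x‖ = ‖F x‖ / l x := fun x => by
    rw [hG, norm_smul, norm_inv, Real.norm_eq_abs, abs_of_pos (hlpos x), inv_mul_eq_div]
  have hG1 : ∀ x, ‖G x‖ ≤ 1 := fun x => by
    rw [hGn, div_le_iff₀ (hlpos x)]
    exact hFl x
  obtain ⟨g, hgs, ⟨C, hC⟩, δ, hδ, hg⟩ :=
    h.exists_perturbation (by simp) hGs hG1 (ε := 1 / 2) (by norm_num)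
  set θ : X → ℝ := fun x => cutoff 1 ‖G x‖ with hθ
  have hθ0 : ∀ x, 0 ≤ θ x := fun x => cutoff_nonneg _ _
  have hθ1 : ∀ x, θ x ≤ 1 := fun x => cutoff_le_one _ _
  set k : X → EuclideanSpace ℝ (Fin m) := fun x => (1 - θ x) • g x with hk
  have hkn : ∀ x, ‖k x‖ ≤ C := fun x => by
    rw [hk, norm_smul, Real.norm_eq_abs, abs_of_nonneg (by linarith [hθ1 x])]
    exact (mul_le_of_le_one_left (norm_nonneg _) (by linarith [hθ0 x])).trans (hC x)
  have hks : SlowOsc k := by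
    refine (hGs.prodMk hgs).comp_continuous ?_
      (g := fun q : EuclideanSpace ℝ (Fin m) × EuclideanSpace ℝ (Fin m) =>
        (1 - cutoff 1 ‖q.1‖) • q.2) ?_
    · refine isBounded_iff_forall_norm_le.2 ⟨max 1 C, ?_⟩
      rintro _ ⟨x, rfl⟩
      exact max_le_max (hG1 x) (hC x)
    · have := continuous_cutoff 1
      fun_prop
  obtain ⟨r, hr0, hrr₁, hrL, hrlim, hrk⟩ := exists_slow_scale hks (D := 2 * C) (fun x y => by
    rw [dist_eq_norm]
    linarith [norm_sub_le (k x) (k y), hkn x, hkn y]) hr₁1 hr₁lim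
  -- The variation of `θ` is multiplied by the unbounded `‖F x‖ ≤ l x`, but it is at most twice that
  -- of `G`, and `l x * ‖G x - G y‖` is controlled by the normalisation estimate.
  have hθF : AsymptoticallyLipschitz fun x => θ x • F x := by
    obtain ⟨M, K, hM, hF⟩ := hF
    obtain ⟨M', K', hM', hlL⟩ := hlL
    refine AsymptoticallyLipschitz.of_bound (M := 3 * M + 2 * M') (A := 3 * K + 2 * K')
      fun x y => ?_
    have h1 : θ x • F x - θ y • F y = (θ x - θ y) • F x + θ y • (F x - F y) := by module
    have h2 : |θ x - θ y| ≤ 2 * ‖G x - G y‖ :=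
      (abs_cutoff_sub_le one_pos _ _).trans (by
        rw [div_one]
        gcongr
        exact abs_norm_sub_norm_le _ _)
    have h3 : l x * ‖G x - G y‖ ≤ ‖F x - F y‖ + 1 * |l x - l y| :=
      mul_norm_inv_smul_sub_le (hlpos x) (hlpos y) (hFl y)
    have h4 : |θ x - θ y| * ‖F x‖ ≤ 2 * ‖G x - G y‖ * l x :=
      mul_le_mul h2 (by simpa using hFl x) (norm_nonneg _) (by positivity)
    have h5 : θ y * ‖F x - F y‖ ≤ ‖F x - F y‖ :=
      mul_le_of_le_one_left (norm_nonneg _) (hθ1 y)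
    have h6 := hF x y
    have h7 := hlL x y
    rw [dist_eq_norm] at h6
    rw [Real.dist_eq] at h7
    rw [dist_eq_norm, h1]
    refine (norm_add_le _ _).trans ?_
    rw [norm_smul, norm_smul, Real.norm_eq_abs, Real.norm_eq_abs, abs_of_nonneg (hθ0 y)]
    linarith
  set w : X → EuclideanSpace ℝ (Fin m) := fun x => θ x • F x + r x • k x with hw
  have hwL : AsymptoticallyLipschitz w :=
    hθF.add (asymptoticallyLipschitz_smul hr0 hrL hkn hrk)
  have hwlim : Tendsto (fun x => ‖w x‖) (cobounded X) atTop := by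
    have hδ' : 0 < min δ (1 / 2) := by positivity
    refine tendsto_atTop_mono' _ ?_ (hrlim.const_mul_atTop hδ')
    filter_upwards [hg] with x ⟨hx1, hx2⟩
    have hrx := hr0 x
    rcases le_or_gt ‖G x‖ (1 / 2) with hle | hlt
    · have h1 : θ x = 0 := cutoff_of_le_half one_pos hle
      have h2 : w x = r x • g x := by simp [hw, hk, h1]
      rw [h2, norm_smul, Real.norm_eq_abs, abs_of_pos hrx, mul_comm]
      gcongr
      exact (min_le_left _ _).trans hx2
    -- Here `g = G`, so both summands of `w` are nonnegative multiples of `G x` and cannot cancel.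
    · have h2 : w x = (θ x * l x + (1 - θ x) * r x) • G x := by
        have h3 : F x = l x • G x := by
          rw [hG, smul_smul, mul_inv_cancel₀ (hlpos x).ne', one_smul]
        rw [hw]
        simp only [hk, hx1 hlt.le]
        rw [h3]
        module
      have h4 : r x ≤ θ x * l x + (1 - θ x) * r x := by
        have h5 : r x ≤ l x := (hrr₁ x).trans (le_max_left _ _)
        nlinarith [hθ0 x]
      rw [h2, norm_smul, Real.norm_eq_abs, abs_of_pos (hrx.trans_le h4), mul_comm]
      exact mul_le_mul h4 ((min_le_right _ _).trans hlt.le) hδ'.le (hrx.le.trans h4)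
  have hwA : ∀ x ∈ A, dist (w x) (F x) ≤ 1 + |C| := by
    intro x hx
    rcases le_or_gt (r₁ x) ‖F x‖ with hle | hlt
    · have h1 : l x = ‖F x‖ := max_eq_right hle
      have h2 : ‖G x‖ = 1 := by
        rw [hGn, h1, div_self ((hr₁pos x).trans_le hle).ne']
      have h3 : θ x = 1 := cutoff_of_le one_pos h2.ge
      have h4 : w x = F x := by simp [hw, hk, h3]
      rw [h4, dist_self]
      positivity
    · have h1 := hr₁b x
      simp only [hx, if_true] at h1
      have h2 : r₁ x ≤ 1 := by
        rcases le_max_iff.1 h1 with h | h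
        · exact h
        · exact absurd hlt (not_lt.2 h)
      have h3 : w x - F x = r x • k x - (1 - θ x) • F x := by
        rw [hw]
        module
      rw [dist_eq_norm, h3]
      refine (norm_sub_le _ _).trans ?_
      rw [norm_smul (r x), norm_smul (1 - θ x) (F x), Real.norm_eq_abs, Real.norm_eq_abs,
        abs_of_pos (hr0 x), abs_of_nonneg (by linarith [hθ1 x])]
      have h4 : r x * ‖k x‖ ≤ 1 * |C| := mul_le_mul ((hrr₁ x).trans h2)
        ((hkn x).trans (le_abs_self C)) (norm_nonneg _) zero_le_one
      have h5 : (1 - θ x) * ‖F x‖ ≤ 1 * 1 := mul_le_mul (by linarith [hθ0 x])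
        (hlt.le.trans h2) (norm_nonneg _) zero_le_one
      linarith
  have hdist : ∀ x, dist (w x) (if x ∈ A then F x else w x) ≤ 1 + |C| := fun x => by
    by_cases hx : x ∈ A
    · simpa [hx] using hwA x hx
    · simp [hx]
      positivity
  -- On `A` the map `w` is only boundedly close to `F`. Overwriting it there preserves the
  -- asymptotic Lipschitz bound and properness.
  refine ⟨fun x => if x ∈ A then F x else w x, ⟨hwL.of_dist_le hdist,
    isBounded_preimage_of_tendsto ?_⟩, fun a => by simp [hFf]⟩
  refine tendsto_atTop_mono (fun x => ?_) (tendsto_atTop_add_const_right _ (-(1 + |C|)) hwlim)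
  have h1 := hdist x
  rw [dist_eq_norm] at h1
  have h2 := norm_sub_norm_le (w x) (if x ∈ A then F x else w x)
  linarith

end Extension

/-! ### The extensor property gives coarse refinements -/

section Converse

variable {X : Type*} [MetricSpace X]

/-- For a slow scale `r`, the map `r • F` is asymptotically Lipschitz, and proper on the closed set
where `‖F‖ ≥ ε`. Extending it properly and dividing by a function comparable to the norm of the
extension gives a map away from 0. -/
theorem IsAbsoluteExtensorOf.exists_perturbation {E : Type*} [NormedAddCommGroup E]
    [NormedSpace ℝ E] (h : IsAbsoluteExtensorOf E X) {F : X → E} (hFc : Continuous F)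
    (hF : SlowOsc F) {C : ℝ} (hC : ∀ x, ‖F x‖ ≤ C) {ε : ℝ} (hε : 0 < ε) :
    ∃ g : X → E, SlowOsc g ∧ (∃ C', ∀ x, ‖g x‖ ≤ C') ∧ ∃ δ > 0,
      ∀ᶠ x in cobounded X, (ε ≤ ‖F x‖ → g x = F x) ∧ δ ≤ ‖g x‖ := by
  obtain ⟨b, hb, hblim⟩ := exists_one_le_tendsto_cobounded X
  obtain ⟨r, hr0, -, hrL, hrlim, hrF⟩ := exists_slow_scale hF (D := 2 * C) (fun x y => by
    rw [dist_eq_norm]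
    linarith [norm_sub_le (F x) (F y), hC x, hC y]) hb hblim
  have hrFL := asymptoticallyLipschitz_smul hr0 hrL hC hrF
  have hA : IsClosed {x | ε ≤ ‖F x‖} := isClosed_le continuous_const hFc.norm
  obtain ⟨w, ⟨hwL, hwp⟩, hwf⟩ := h {x | ε ≤ ‖F x‖} hA (fun a => r a • F a) (by
    refine ⟨?_, fun B hB => ?_⟩
    · obtain ⟨M, K, hM, hMK⟩ := hrFL
      exact ⟨M, K, hM, fun a a' => hMK a a'⟩
    · obtain ⟨N, hN⟩ := isBounded_iff_forall_norm_le.1 hB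
      have h1 : IsBounded {x | r x ≤ N / ε} := by
        rw [isBounded_def]
        filter_upwards [hrlim.eventually_gt_atTop (N / ε)] with x hx hxN
        exact absurd hxN (not_le.2 hx)
      rw [← isBounded_image_subtype_val]
      refine h1.subset ?_
      rintro _ ⟨⟨a, ha⟩, haB, rfl⟩
      have h2 := hN _ haB
      rw [norm_smul, Real.norm_eq_abs, abs_of_pos (hr0 a)] at h2
      change r a ≤ N / ε
      rw [le_div_iff₀ hε]
      exact (mul_le_mul_of_nonneg_left ha (hr0 a).le).trans h2)
  have hwlim : Tendsto (fun x => ‖w x‖) (cobounded X) atTop := by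
    rw [tendsto_atTop]
    intro N
    have h1 := hwp _ (Metric.isBounded_ball (x := (0 : E)) (r := N))
    rw [isBounded_def] at h1
    filter_upwards [h1] with x hx
    by_contra hlt
    exact hx (mem_ball_zero_iff.2 (not_le.1 hlt))
  set D : ℝ := max C ε with hD
  have hDpos : 0 < D := hε.trans_le (le_max_right _ _)
  -- Near infinity this clamps `r` between `‖w‖ / D` and `‖w‖ / ε`. Where `‖F‖ ≥ ε` one has `‖w‖ = r
  -- * ‖F‖` with `ε ≤ ‖F‖ ≤ D`, so the clamp is inactive and `l = r`, which returns `F` exactly.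
  set l : X → ℝ := fun x => max (max (min (r x) (‖w x‖ / ε)) 1) (‖w x‖ / D) with hl
  have hl1 : ∀ x, 1 ≤ l x := fun x => (le_max_right _ _).trans (le_max_left _ _)
  have hlpos : ∀ x, 0 < l x := fun x => one_pos.trans_le (hl1 x)
  have hlL : AsymptoticallyLipschitz l := by
    have h1 : AsymptoticallyLipschitz fun _ : X => (1 : ℝ) :=
      AsymptoticallyLipschitz.of_lipschitz fun x y => by simp
    exact (((AsymptoticallyLipschitz.of_lipschitz hrL).min (hwL.norm_div hε)).max h1).max
      (hwL.norm_div hDpos)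
  have hwl : ∀ x, ‖w x‖ ≤ D * l x := fun x => by
    rw [← div_le_iff₀' hDpos]
    exact le_max_right _ _
  have hllim : Tendsto l (cobounded X) atTop :=
    tendsto_atTop_mono (fun x => le_max_right _ _) (hwlim.atTop_div_const hDpos)
  refine ⟨fun x => (l x)⁻¹ • w x, slowOsc_inv_smul hwL hlL hlpos hwl hllim, ⟨D, fun x => ?_⟩,
    ε, hε, ?_⟩
  · rw [norm_smul, norm_inv, Real.norm_eq_abs, abs_of_pos (hlpos x), inv_mul_le_iff₀ (hlpos x),
      mul_comm]
    exact hwl x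
  · filter_upwards [hrlim.eventually_ge_atTop 1, hwlim.eventually_ge_atTop ε] with x hrx hwx
    constructor
    · intro hx
      have h1 : w x = r x • F x := hwf ⟨x, hx⟩
      have h2 : ‖w x‖ = r x * ‖F x‖ := by
        rw [h1, norm_smul, Real.norm_eq_abs, abs_of_pos (hr0 x)]
      have h3 : r x ≤ ‖w x‖ / ε := by
        rw [le_div_iff₀ hε, h2]
        exact mul_le_mul_of_nonneg_left hx (hr0 x).le
      have h4 : ‖w x‖ / D ≤ r x := by
        rw [div_le_iff₀ hDpos, h2]
        exact mul_le_mul_of_nonneg_left ((hC x).trans (le_max_left _ _)) (hr0 x).le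
      have h5 : l x = r x := by
        rw [hl]
        simp only [min_eq_left h3, max_eq_left hrx, max_eq_left h4]
      rw [h5, h1, smul_smul, inv_mul_cancel₀ (hr0 x).ne', one_smul]
    · have h1 : l x ≤ ‖w x‖ / ε := by
        refine max_le (max_le (min_le_right _ _) ?_) ?_
        · rwa [le_div_iff₀ hε, one_mul]
        · exact div_le_div_of_nonneg_left (norm_nonneg _) hε (le_max_right _ _)
      rw [norm_smul, norm_inv, Real.norm_eq_abs, abs_of_pos (hlpos x), le_inv_mul_iff₀ (hlpos x)]
      rwa [le_div_iff₀ hε] at h1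

/-- If `ℝ^m` is an absolute extensor of `X`, then every coarse family of `m + 1` sets can be
shrunk to a coarse family with empty intersection. -/
theorem IsAbsoluteExtensorOf.exists_shrinking_fin {m : ℕ}
    (h : IsAbsoluteExtensorOf (EuclideanSpace ℝ (Fin m)) X) {U : Fin (m + 1) → Set X}
    (hU : IsCoarseFamily (Set.range U)) :
    ∃ W : Fin (m + 1) → Set X, IsCoarseFamily (Set.range W) ∧ (∀ i, W i ⊆ U i) ∧
      ∀ x, ∃ i, x ∉ W i := by
  obtain ⟨φ, hφc, hφs, hφ0, hφ1, hφU, hφsum⟩ := exists_slowOsc_partition hU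
  -- `F` vanishes exactly where all `φ i` are equal; near infinity this is the barycentre.
  set F : X → EuclideanSpace ℝ (Fin m) :=
    fun x => WithLp.toLp 2 fun j => φ j.succ x - φ 0 x with hF
  have hFc : Continuous F := by fun_prop
  have hFs : SlowOsc F := by
    have h1 : SlowOsc fun x => fun i => φ i x := slowOsc_pi.2 hφs
    refine h1.comp_continuous ?_
      (g := fun v : Fin (m + 1) → ℝ => (WithLp.toLp 2 fun j : Fin m => v j.succ - v 0 :
        EuclideanSpace ℝ (Fin m))) (by fun_prop)
    refine isBounded_iff_forall_norm_le.2 ⟨1, ?_⟩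
    rintro _ ⟨x, rfl⟩
    refine (pi_norm_le_iff_of_nonneg zero_le_one).2 fun i => ?_
    rw [Real.norm_eq_abs, abs_of_nonneg (hφ0 i x)]
    exact hφ1 i x
  have hFC : ∀ x, ‖F x‖ ≤ m := fun x => by
    refine (norm_le_sum_abs _).trans ?_
    refine (Finset.sum_le_card_nsmul _ _ 1 fun j _ => ?_).trans_eq (by simp)
    exact abs_sub_le_iff.2 ⟨by linarith [hφ1 j.succ x, hφ0 0 x],
      by linarith [hφ1 0 x, hφ0 j.succ x]⟩
  obtain ⟨g, hgs, ⟨C, hC⟩, δ, hδ, hg⟩ :=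
    h.exists_perturbation hFc hFs hFC (ε := 1 / (2 * (m + 1))) (by positivity)
  -- `ψ` recovers all `φ i` from `φ 0` and `F`. With `g` in place of `F`, subtracting the minimum
  -- `μ` makes some coordinate vanish at every point, which gives the empty intersection.
  let ψ : Fin (m + 1) → ℝ × EuclideanSpace ℝ (Fin m) → ℝ :=
    fun i q => Fin.cases q.1 (fun j => q.1 + q.2 j) i
  have hψ0 : ∀ q, ψ 0 q = q.1 := fun q => rfl
  have hψs : ∀ j q, ψ (Fin.succ j) q = q.1 + q.2 j := fun j q => rfl
  have hψc : ∀ i, Continuous (ψ i) := by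
    refine Fin.cases ?_ fun j => ?_
    · exact continuous_fst
    · change Continuous fun q : ℝ × EuclideanSpace ℝ (Fin m) => q.1 + q.2 j
      fun_prop
  let μ : ℝ × EuclideanSpace ℝ (Fin m) → ℝ :=
    fun q => Finset.univ.inf' Finset.univ_nonempty fun i => ψ i q
  have hμc : Continuous μ := Continuous.finset_inf'_apply _ fun i _ => hψc i
  have hμ : ∀ i q, μ q ≤ ψ i q := fun i q => Finset.inf'_le _ (Finset.mem_univ i)
  have hslow : ∀ i, SlowOsc fun x => ψ i (φ 0 x, g x) - μ (φ 0 x, g x) := fun i => by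
    refine ((hφs 0).prodMk hgs).comp_continuous ?_ (g := fun q => ψ i q - μ q)
      ((hψc i).sub hμc)
    refine isBounded_iff_forall_norm_le.2 ⟨max 1 C, ?_⟩
    rintro _ ⟨x, rfl⟩
    refine max_le_max ?_ (hC x)
    rw [Real.norm_eq_abs, abs_of_nonneg (hφ0 0 x)]
    exact hφ1 0 x
  refine ⟨fun i => {x | x ∈ U i ∧ 0 < ψ i (φ 0 x, g x) - μ (φ 0 x, g x)}, ?_,
    fun i x hx => hx.1, fun x => ?_⟩
  · refine isCoarseFamily_range_of_slowOsc hslow (δ := δ / (m + 1)) (by positivity) ?_ ?_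
    · filter_upwards [hg] with x ⟨_, hx⟩
      by_contra hcon
      push Not at hcon
      -- The coordinates of `g` are differences `ψ j.succ - ψ 0`. If all `ψ i - μ` were below `δ /
      -- (m + 1)`, the norm of `g` would be below `δ`.
      have h1 : ‖g x‖ ≤ m * (δ / (m + 1)) := by
        refine (norm_le_sum_abs _).trans ?_
        refine (Finset.sum_le_card_nsmul _ _ (δ / (m + 1)) fun j _ => ?_).trans_eq (by simp)
        have h2 := hcon j.succ
        have h3 := hcon 0
        have h4 := hμ j.succ (φ 0 x, g x)
        have h5 := hμ 0 (φ 0 x, g x)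
        rw [hψs] at h2 h4
        rw [hψ0] at h3 h5
        exact abs_le.2 ⟨by linarith, by linarith⟩
      have h2 : m * (δ / (m + 1)) < δ := by
        rw [mul_div_assoc', div_lt_iff₀ (by positivity)]
        nlinarith
      linarith
    · filter_upwards [hg, hφsum] with x ⟨hx, _⟩ hsum i hi
      refine ⟨hφU i x fun hzero => ?_, hi⟩
      -- If one `φ i` vanishes and `F` is small, every `φ i'` is below `1 / (m + 1)`, so they cannot
      -- sum to 1. Hence `g = F` there and `ψ` returns `φ`.
      have hnorm : 1 / (2 * ((m : ℝ) + 1)) ≤ ‖F x‖ := by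
        by_contra hlt
        push Not at hlt
        have h1 : ∀ j : Fin m, |φ j.succ x - φ 0 x| < 1 / (2 * (m + 1)) := fun j =>
          (PiLp.norm_apply_le (F x) j).trans_lt hlt
        have h2 : φ 0 x < 1 / (2 * (m + 1)) := by
          revert hzero
          refine Fin.cases (fun h0 => ?_) (fun j hj => ?_) i
          · rw [h0]
            positivity
          · have := h1 j
            rw [hj, zero_sub, abs_neg] at this
            exact (le_abs_self _).trans_lt this
        have h3 : ∀ i', φ i' x < 1 / (m + 1) := by
          have h4 : 1 / ((m : ℝ) + 1) = 1 / (2 * (m + 1)) + 1 / (2 * (m + 1)) := by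
            field_simp
            norm_num
          refine Fin.cases ?_ fun j => ?_
          · linarith [(by positivity : (0 : ℝ) < 1 / (2 * (m + 1)))]
          · linarith [(abs_lt.1 (h1 j)).2]
        have h5 : ∑ i', φ i' x < ∑ _i' : Fin (m + 1), 1 / ((m : ℝ) + 1) :=
          Finset.sum_lt_sum_of_nonempty Finset.univ_nonempty fun i' _ => h3 i'
        rw [hsum, Finset.sum_const, Finset.card_univ, Fintype.card_fin, nsmul_eq_mul] at h5
        push_cast at h5
        rw [mul_one_div_cancel (by positivity)] at h5
        exact lt_irrefl _ h5
      have hψφ : ∀ i', ψ i' (φ 0 x, g x) = φ i' x := by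
        rw [hx hnorm]
        refine Fin.cases rfl fun j => ?_
        rw [hψs]
        simp [hF]
      have h1 : 0 ≤ μ (φ 0 x, g x) := Finset.le_inf' _ _ fun i' _ => by
        rw [hψφ]
        exact hφ0 i' x
      rw [hψφ, hzero] at hi
      linarith
  · obtain ⟨i, -, hi⟩ := Finset.exists_mem_eq_inf' Finset.univ_nonempty
      fun i => ψ i (φ 0 x, g x)
    refine ⟨i, fun hx => ?_⟩
    have h1 : μ (φ 0 x, g x) = ψ i (φ 0 x, g x) := hi
    have h2 := hx.2
    rw [h1, sub_self] at h2
    exact lt_irrefl _ h2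

/-- Shrinking of families grouped into `m + 1` classes, for spaces in which coarse families of
`m + 1` sets can be shrunk to coarse families with empty intersection. -/
theorem exists_shrinking_of_grouping {m : ℕ}
    (h : ∀ U : Fin (m + 1) → Set X, IsCoarseFamily (Set.range U) →
      ∃ W : Fin (m + 1) → Set X, IsCoarseFamily (Set.range W) ∧ (∀ i, W i ⊆ U i) ∧
        ∀ x, ∃ i, x ∉ W i)
    {κ : Type*} [Fintype κ] {U : κ → Set X} (hU : IsCoarseFamily (Set.range U))
    (q : κ → Fin (m + 1)) :
    ∃ W : κ → Set X, IsCoarseFamily (Set.range W) ∧ (∀ i, W i ⊆ U i) ∧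
      ∀ x, ∃ j, ∀ i, q i = j → x ∉ W i := by
  classical
  obtain ⟨φ, -, hφs, hφ0, hφ1, hφU, hφsum⟩ := exists_slowOsc_partition hU
  set Φ : Fin (m + 1) → X → ℝ := fun j x => ∑ i with q i = j, φ i x with hΦ
  have hφv : SlowOsc fun x => fun i => φ i x := slowOsc_pi.2 hφs
  have hΦs : ∀ c : ℝ, ∀ j, SlowOsc fun x => Φ j x - c := fun c j => by
    refine hφv.comp_continuous ?_ (g := fun v : κ → ℝ => (∑ i with q i = j, v i) - c)
      (by fun_prop)
    refine isBounded_iff_forall_norm_le.2 ⟨1, ?_⟩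
    rintro _ ⟨x, rfl⟩
    refine (pi_norm_le_iff_of_nonneg zero_le_one).2 fun i => ?_
    rw [Real.norm_eq_abs, abs_of_nonneg (hφ0 i x)]
    exact hφ1 i x
  set c : ℝ := 1 / (2 * (m + 1)) with hc
  have hcpos : 0 < c := by positivity
  have hcoarse : IsCoarseFamily (Set.range fun j => {x | c < Φ j x}) := by
    refine isCoarseFamily_range_of_slowOsc (hΦs c) hcpos ?_
      (Eventually.of_forall fun x j hx => sub_pos.1 hx)
    filter_upwards [hφsum] with x hx
    by_contra hcon
    push Not at hcon
    have h1 : ∑ j, Φ j x = 1 := by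
      rw [← hx]
      exact Finset.sum_fiberwise _ q fun i => φ i x
    have h2 : ∑ j, Φ j x < ∑ _j : Fin (m + 1), 2 * c :=
      Finset.sum_lt_sum_of_nonempty Finset.univ_nonempty fun j _ => by linarith [hcon j]
    rw [h1, Finset.sum_const, Finset.card_univ, Fintype.card_fin, nsmul_eq_mul, hc] at h2
    push_cast at h2
    have h3 : ((m : ℝ) + 1) * (2 * (1 / (2 * (m + 1)))) = 1 := by field_simp
    rw [h3] at h2
    exact lt_irrefl _ h2
  obtain ⟨B, hB, hBΦ, hBe⟩ := h _ hcoarse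
  -- A class sum above `c` forces some member of that class to be at least `2 * η`; it then stays
  -- above `η` on the whole ball.
  set η : ℝ := c / (2 * (Fintype.card κ + 1)) with hη
  have hηpos : 0 < η := by positivity
  refine ⟨fun i => {x | x ∈ B (q i) ∧ η < φ i x}, ?_, fun i x hx => hφU i x ?_, fun x => ?_⟩
  · rw [isCoarseFamily_iff] at hB ⊢
    intro R
    have h1 : ∀ᶠ x in cobounded X, ∀ i, ∀ y, dist x y ≤ R → dist (φ i x) (φ i y) < η :=
      eventually_all.2 fun i => slowOsc_iff.1 (hφs i) R η hηpos
    filter_upwards [hB (max R 0), h1] with x ⟨_, ⟨j, rfl⟩, hball⟩ h1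
    have h2 : c < Φ j x := hBΦ j (hball x (by simp))
    obtain ⟨i, hij, hi⟩ : ∃ i, q i = j ∧ 2 * η ≤ φ i x := by
      by_contra hcon
      push Not at hcon
      have h3 : Φ j x ≤ ∑ i with q i = j, 2 * η :=
        Finset.sum_le_sum fun i hi => (hcon i (Finset.mem_filter.1 hi).2).le
      have h4 : ∑ i with q i = j, 2 * η ≤ ∑ _i : κ, 2 * η :=
        Finset.sum_le_sum_of_subset_of_nonneg (Finset.filter_subset _ _)
          fun _ _ _ => by positivity
      rw [Finset.sum_const (2 * η) (s := Finset.univ), Finset.card_univ, nsmul_eq_mul] at h4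
      have h5 : ((Fintype.card κ : ℝ) + 1) * (2 * η) = c := by
        rw [hη]
        field_simp
      linarith
    refine ⟨_, ⟨i, rfl⟩, fun y hy => ⟨?_, ?_⟩⟩
    · rw [hij]
      exact hball y (hy.trans (le_max_left _ _))
    · have h3 := h1 i y hy
      rw [Real.dist_eq, abs_lt] at h3
      linarith [h3.2]
  · exact (hηpos.trans hx.2).ne'
  · obtain ⟨j, hj⟩ := hBe x
    exact ⟨j, fun i hi hx => hj (hi ▸ hx.1)⟩

/-- Order at most `m` means that any `m + 1` members have empty intersection. The finitely many
index sets `S` of size `m + 1` are treated one at a time, and later shrinkings keep earlier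
intersections empty. -/
theorem IsAbsoluteExtensorOf.hasCoarseRefinements {m : ℕ}
    (h : IsAbsoluteExtensorOf (EuclideanSpace ℝ (Fin m)) X) : HasCoarseRefinements X m := by
  classical
  refine hasCoarseRefinements_of_shrinking fun 𝒰 hfin hU => ?_
  have := hfin.fintype
  have key : ∀ T : Finset (Finset 𝒰), ∃ W : 𝒰 → Set X, IsCoarseFamily (Set.range W) ∧
      (∀ i, W i ⊆ i) ∧ ∀ S ∈ T, S.card = m + 1 → ∀ x, ∃ i ∈ S, x ∉ W i := by
    intro T
    induction T using Finset.induction_on with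
    | empty => exact ⟨_, hU, fun i => subset_rfl, by simp⟩
    | insert S T _ ih =>
      obtain ⟨W, hW, hWU, hWT⟩ := ih
      by_cases hS : S.card = m + 1
      · let e := S.equivFinOfCardEq hS
        obtain ⟨W', hW', hWW', he⟩ := exists_shrinking_of_grouping
          (fun U hU => h.exists_shrinking_fin hU) hW
          -- Each element of `S` gets its own class, and the remaining indices may join any class. A
          -- class missed by a point then contains an element of `S` whose set misses that point.
          (fun i => if hi : i ∈ S then e ⟨i, hi⟩ else 0)
        refine ⟨W', hW', fun i => (hWW' i).trans (hWU i), fun S' hS' hcard x => ?_⟩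
        rcases Finset.mem_insert.1 hS' with rfl | hS'
        · obtain ⟨j, hj⟩ := he x
          refine ⟨e.symm j, (e.symm j).2, hj _ ?_⟩
          simp
        · obtain ⟨i, hi, hxi⟩ := hWT S' hS' hcard x
          exact ⟨i, hi, fun hx => hxi (hWW' i hx)⟩
      · refine ⟨W, hW, hWU, fun S' hS' hcard x => ?_⟩
        rcases Finset.mem_insert.1 hS' with rfl | hS'
        · exact absurd hcard hS
        · exact hWT S' hS' hcard x
  obtain ⟨W, hW, hWU, hWe⟩ := key Finset.univ
  refine ⟨W, hW, hWU, fun x S hS => ?_⟩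
  by_contra hlt
  obtain ⟨S', hS', hcard⟩ := Finset.exists_subset_card_eq (Nat.succ_le_of_lt (not_le.1 hlt))
  obtain ⟨i, hi, hxi⟩ := hWe S' (Finset.mem_univ _) hcard x
  exact hxi (hS i (hS' hi))

theorem coarseDim_eq_dranishnikovCoarseDim (X : Type*) [MetricSpace X] :
    coarseDim X = dranishnikovCoarseDim X := by
  unfold coarseDim dranishnikovCoarseDim
  refine iInf_congr fun m => iInf_congr_Prop ?_ fun _ => rfl
  exact ⟨HasCoarseRefinements.isAbsoluteExtensorOf, IsAbsoluteExtensorOf.hasCoarseRefinements⟩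

end Converse

end Coarse

theorem mainTheorem7 (X : Type u) [MetricSpace X] [ProperSpace X] :
    (∃ (H : Type u) (_ : TopologicalSpace H) (ι : X → H), Coarse.IsHigsonCompactification ι) ∧
    (∀ (H : Type v) [TopologicalSpace H] (ι : X → H), Coarse.IsHigsonCompactification ι →
      Coarse.coveringDim (Coarse.HigsonCorona ι) = Coarse.coarseDim X) ∧
    Coarse.coarseDim X = Coarse.dranishnikovCoarseDim X := by
  refine ⟨⟨_, inferInstance, Coarse.toHigson X, Coarse.isHigsonCompactification_toHigson⟩,
    fun H _ ι h => h.coveringDim_corona, Coarse.coarseDim_eq_dranishnikovCoarseDim X⟩
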